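/- Let $H$ be a finite graph without multiple edges, possibly with loops, having at least one edge or loop, and let $\Lambda=(\lambda_i)_{i\in V(H)}$ be positive real weights. For a finite simple graph $G$ with $V(G)\neq\emptyset$ let $\mathrm{Hom}(G,H)$ be the set of maps $c:V(G)\to V(H)$ that preserve adjacency. When it is non-empty, let $p_\Lambda$ be the probability distribution on $\mathrm{Hom}(G,H)$ with $p_\Lambda(c)$ proportional to $\prod_{v\in V(G)}\lambda_{c(v)}$. For $k\in V(H)$ put $$s(k,c)=\frac{|c^{-1}(k)|}{|V(G)|},\qquad \bar p_\Lambda(k)=\frac1{|V(G)|}\sum_{v\in V(G)}p_\Lambda(c(v)=k).$$ For $A,B\subseteq V(H)$ write $w_\Lambda(A)=\sum_{i\in A}\lambda_i$, $w_\Lambda(H)=w_\Lambda(V(H))$, and $A\sim B$ if every $u\in A$ and $v\in B$ are adjacent in $H$. Let $\eta_\Lambda(H)=\max\{w_\Lambda(A)w_\Lambda(B):A\sim B\}$, let $\mathcal M_\Lambda(H)$ be the set of ordered pairs $(A,B)$ with $A\sim B$ and $w_\Lambda(A)w_\Lambda(B)=\eta_\Lambda(H)$, and put $$a^+_\Lambda(k)=\frac{\max\{w_\Lambda(A)\lambda_k\mathbf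 1_{\{k\in B\}}+w_\Lambda(B)\lambda_k\mathbf 1_{\{k\in A\}}:(A,B)\in\mathcal M_\Lambda(H)\}}{2\eta_\Lambda(H)},$$ with $a^-_\Lambda(k)$ defined in the same way with $\min$ in place of $\max$. For real $\varepsilon$ let $I_k(\varepsilon)=[0,a^-_\Lambda(k)-\varepsilon)\cup(a^+_\Lambda(k)+\varepsilon,1]$. For $0\le p\le1$ let $G_p$ be the random spanning subgraph of $G$ obtained by keeping each edge independently with probability $p$. **Statement.** Let $f:\mathbb N\to\mathbb R$ satisfy $f(n)\to\infty$. There is a function $g:\mathbb N\to\mathbb R$ with $g(n)\to0$, depending only on $H$, $\Lambda$ and $f$, such that for every $n\ge1$, every non-empty finite $n$-regular bipartite graph $G^n$ and every $p\in[0,1]$ the following hold. 1. If $p\ge f(n)/n$, then with probability at least $1-g(n)$ the graph $G^n_p$ is such that for every $k\in V(H)$ $$p_\Lambda\big(s(k,c)\in I_k(g(n))\big)\le g(n)\quad\text{and}\quad \bar p_\Lambda(k)\in\big[a^-_\Lambda(k)-g(n),\,a^+_\Lambda(k)+g(n)\big].$$ 2. If $p\le 1/(f(n)\,n)$, then with probability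 at least $1-g(n)$ the graph $G^n_p$ is such that for every $k\in V(H)$ $$p_\Lambda\Big(\Big|s(k,c)-\frac{\lambda_k}{w_\Lambda(H)}\Big|\le g(n)\Big)\ge1-g(n)\quad\text{and}\quad \Big|\bar p_\Lambda(k)-\frac{\lambda_k}{w_\Lambda(H)}\Big|\le g(n).$$ Here $p_\Lambda$, $s$ and $\bar p_\Lambda$ refer to $H$-colourings $c$ of $G^n_p$. -/

import Mathlib

open Filter Topology

namespace HColouring

/-- A graph without multiple edges in which loops are allowed: a symmetric relation. -/
structure LoopGraph (W : Type*) where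
  Adj : W → W → Prop
  symm : ∀ i j, Adj i j → Adj j i

section Target

variable {W : Type*} [Fintype W] (H : LoopGraph W) (lam : W → ℝ)

/-- `w_Λ(A) = ∑_{i ∈ A} λ_i`. -/
def setWeight (A : Finset W) : ℝ := ∑ i ∈ A, lam i

/-- `A ∼ B`: every vertex of `A` is adjacent in `H` to every vertex of `B`. -/
def FullyAdj (A B : Finset W) : Prop := ∀ u ∈ A, ∀ v ∈ B, H.Adj u v

open Classical in
/-- The ordered pairs `(A, B)` of subsets of `V(H)` with `A ∼ B`. -/
noncomputable def fullPairs : Finset (Finset W × Finset W) :=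
  Finset.univ.filter fun P => FullyAdj H P.1 P.2

theorem fullPairs_nonempty : (fullPairs H).Nonempty :=
  by
  classical
  exact ⟨(∅, ∅), by rw [fullPairs, Finset.mem_filter]; simp [FullyAdj]⟩

/-- `η_Λ(H) = max {w_Λ(A) w_Λ(B) : A ∼ B}`. -/
noncomputable def eta : ℝ :=
  (fullPairs H).sup' (fullPairs_nonempty H) fun P => setWeight lam P.1 * setWeight lam P.2

open Classical in
/-- `M_Λ(H)`: the pairs `A ∼ B` with `w_Λ(A) w_Λ(B) = η_Λ(H)`. -/
noncomputable def maxPairs : Finset (Finset W × Finset W) :=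
  (fullPairs H).filter fun P => setWeight lam P.1 * setWeight lam P.2 = eta H lam

theorem maxPairs_nonempty : (maxPairs H lam).Nonempty := by
  obtain ⟨P, hP, h⟩ := Finset.exists_mem_eq_sup' (fullPairs_nonempty H)
    fun P : Finset W × Finset W => setWeight lam P.1 * setWeight lam P.2
  exact ⟨P, by simp only [maxPairs, Finset.mem_filter]; exact ⟨hP, h.symm⟩⟩

open Classical in
/-- `w_Λ(A) λ_k 1_{k ∈ B} + w_Λ(B) λ_k 1_{k ∈ A}`. -/
noncomputable def pairValue (k : W) (P : Finset W × Finset W) : ℝ :=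
  setWeight lam P.1 * lam k * (if k ∈ P.2 then 1 else 0)
    + setWeight lam P.2 * lam k * (if k ∈ P.1 then 1 else 0)

/-- `a_Λ^+(k)`. -/
noncomputable def aPlus (k : W) : ℝ :=
  (maxPairs H lam).sup' (maxPairs_nonempty H lam) (pairValue lam k) / (2 * eta H lam)

/-- `a_Λ^-(k)`. -/
noncomputable def aMinus (k : W) : ℝ :=
  (maxPairs H lam).inf' (maxPairs_nonempty H lam) (pairValue lam k) / (2 * eta H lam)

/-- `I_k(ε) = [0, a_Λ^-(k) - ε) ∪ (a_Λ^+(k) + ε, 1]`. -/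
def badSet (k : W) (ε : ℝ) : Set ℝ :=
  Set.Ico 0 (aMinus H lam k - ε) ∪ Set.Ioc (aPlus H lam k + ε) 1

end Target

section Model

variable {V W : Type*} [Fintype V] [Fintype W]

open Classical in
/-- `Hom(G, H)`: the maps `V(G) → V(H)` that preserve adjacency. -/
noncomputable def homs (G : SimpleGraph V) (H : LoopGraph W) : Finset (V → W) :=
  Finset.univ.filter fun c => ∀ u v, G.Adj u v → H.Adj (c u) (c v)

/-- `w_Λ(c) = ∏_v λ_{c(v)}`. -/
def colWeight (lam : W → ℝ) (c : V → W) : ℝ := ∏ v, lam (c v)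

/-- The partition function `Z_Λ(G, H)`. -/
noncomputable def partitionFn (G : SimpleGraph V) (H : LoopGraph W) (lam : W → ℝ) : ℝ :=
  ∑ c ∈ homs G H, colWeight lam c

open Classical in
/-- `p_Λ(S)`, for an event `S`: the probability that a colouring chosen from `Hom(G, H)` with
probability `w_Λ(c) / Z_Λ(G, H)` lies in `S`. -/
noncomputable def colProb (G : SimpleGraph V) (H : LoopGraph W) (lam : W → ℝ)
    (S : Set (V → W)) : ℝ :=
  ∑ c ∈ (homs G H).filter (fun c => c ∈ S), colWeight lam c / partitionFn G H lam

open Classical in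
/-- `s(k, c) = |c⁻¹(k)| / |V(G)|`. -/
noncomputable def proportion (k : W) (c : V → W) : ℝ :=
  ((Finset.univ.filter fun v => c v = k).card : ℝ) / (Fintype.card V : ℝ)

/-- `p̄_Λ(k) = (1 / |V(G)|) ∑_v p_Λ(c(v) = k)`. -/
noncomputable def meanProportion (G : SimpleGraph V) (H : LoopGraph W) (lam : W → ℝ)
    (k : W) : ℝ :=
  (1 / (Fintype.card V : ℝ)) * ∑ v, colProb G H lam {c | c v = k}

open Classical in
/-- The probability that the percolated graph `G_p` lies in the set `S` of graphs on `V(G)`.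
The graph `G_p` keeps all vertices, and its edge set is a given `T ⊆ E(G)` with probability
`p^|T| (1 - p)^(|E(G)| - |T|)`. -/
noncomputable def percProb (G : SimpleGraph V) (p : ℝ) (S : Set (SimpleGraph V)) : ℝ :=
  ∑ T ∈ G.edgeFinset.powerset.filter
      (fun T : Finset (Sym2 V) => SimpleGraph.fromEdgeSet (T : Set (Sym2 V)) ∈ S),
    p ^ T.card * (1 - p) ^ (G.edgeFinset.card - T.card)

end Model

end HColouring

/-! Write `m = |V| / 2` for the size of a part. The dense case is a Chernoff bound. Multiplying
`λ_k` by `e^(σt)` turns the partition function into an exponential moment of `|c⁻¹(k)|`, so a tail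
of `s(k, c)` is at most the ratio of the tilted to the original partition function, divided by an
exponential.

Below, every spanning subgraph has partition function at least `η ^ m`: colour the two parts from an
optimal pair (`RegularBipartition.eta_pow_le_partitionFn`). Above, the expected partition function
of `G_p` is at most `(η e^δ) ^ m` for large `n` (`eventually_percExp_partitionFn_le`), and Markov's
inequality passes this to a typical `G_p`. The averaging replaces each forbidden edge by a factor `1
- p`. Summing out one part leaves a product of star factors, one per vertex of that part, and each
vertex of the other part enters `n` of them. Finner's inequality (`sum_prod_le_prod_rpow`) then
reduces the problem to the `n`-th moment of a single star. There, if `A` is the set of colours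
frequent on the leaves, the centre essentially takes colours adjacent to all of `A`, since any other
costs `(1 - p) ^ (θn) ≤ e^(-θ f(n))`; hence the rate `η`.

For small tilts the growth of `log η` is governed by the optimal pairs (`eventually_eta_tilt_le`),
and this is where `a⁺` and `a⁻` come from (`σ = 1` and `σ = -1`).

In the sparse case almost all vertices of `G_p` are isolated. Their colours are independent with law
`λ_k / w`, and Chebyshev's inequality applies (`colExp_sq_le`).

Both cases give a statement for each fixed `ε` and large `n`; a diagonal choice produces `g`. -/

namespace HColouring

/-! ### Finner's inequality -/

section Finner

open MeasureTheory ENNReal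

/-- Finner's inequality: if every coordinate occurs in at most `n` of the functions, the
integral of their product is at most the product of their `L^n` norms. -/
theorem lmarginal_prod_le {ι L W : Type*} [Fintype L] [DecidableEq L] [Finite W]
    [MeasurableSpace W] [DiscreteMeasurableSpace W] (μ : Measure W) [IsProbabilityMeasure μ]
    [Fintype ι] {n : ℕ} (hn : 0 < n) (E : L → ι → Prop) [∀ u, DecidablePred (E u)]
    (hE : ∀ u, (Finset.univ.filter (E u)).card ≤ n) (F : ι → (L → W) → ℝ≥0∞)
    (hF : ∀ r, DependsOn (F r) {u | E u r}) (T : Finset L) (x : L → W) :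
    (∫⋯∫⁻_T, (fun a => ∏ r, F r a) ∂(fun _ => μ)) x
      ≤ ∏ r, ((∫⋯∫⁻_T, (fun a => F r a ^ n) ∂(fun _ => μ)) x) ^ (1 / n : ℝ) := by
  have hn' : (n : ℝ) ≠ 0 := by positivity
  induction T using Finset.induction_on generalizing x with
  | empty =>
    simp only [lmarginal_empty]
    refine le_of_eq (Finset.prod_congr rfl fun r _ => ?_)
    rw [← ENNReal.rpow_natCast, ← ENNReal.rpow_mul, mul_one_div_cancel hn', ENNReal.rpow_one]
  | insert u T hu ih =>
    set K : ι → (L → W) → ℝ≥0∞ := fun r => ∫⋯∫⁻_T, (fun a => F r a ^ n) ∂(fun _ => μ) with hK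
    have hKu : ∀ r, ¬ E u r → ∀ x y, K r (Function.update x u y) = K r x := by
      intro r hr x y
      simp only [hK, lmarginal]
      refine lintegral_congr fun z => ?_
      congr 1
      refine hF r fun i hi => ?_
      have : i ≠ u := by rintro rfl; exact hr hi
      simp only [Function.updateFinset]
      split_ifs <;> simp [this]
    rw [lmarginal_insert _ .of_discrete hu]
    calc _ ≤ ∫⁻ y, ∏ r, K r (Function.update x u y) ^ (1 / n : ℝ) ∂μ :=
          lintegral_mono fun y => ih _
      _ = (∏ r with ¬ E u r, K r x ^ (1 / n : ℝ)) *
            ∫⁻ y, ∏ r with E u r, K r (Function.update x u y) ^ (1 / n : ℝ) ∂μ := by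
          rw [← lintegral_const_mul _ .of_discrete]
          refine lintegral_congr fun y => ?_
          rw [← Finset.prod_filter_mul_prod_filter_not Finset.univ (E u), mul_comm]
          congr 1
          refine Finset.prod_congr rfl fun r hr => ?_
          rw [hKu r (by simpa using hr)]
      _ ≤ (∏ r with ¬ E u r, K r x ^ (1 / n : ℝ)) *
            ∏ r with E u r, (∫⁻ y, K r (Function.update x u y) ∂μ) ^ (1 / n : ℝ) := by
          gcongr
          -- Hölder with exponent `1 / n` on each of the at most `n` factors that involve `u`; the
          -- constant function `1` takes up the rest of the total exponent `1`.
          have := lintegral_mul_prod_norm_pow_le (μ := μ) (Finset.univ.filter (E u))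
            (g := fun _ => 1) (f := fun r y => K r (Function.update x u y)) .of_discrete
            (fun _ _ => .of_discrete) (1 - (Finset.univ.filter (E u)).card * (1 / n : ℝ))
            (p := fun _ => 1 / n) (by simp) ?_ (fun _ _ => by positivity)
          · simpa using this
          · have := hE u
            rw [sub_nonneg, mul_one_div]
            exact div_le_one_of_le₀ (by exact_mod_cast this) (by positivity)
      _ = _ := by
          rw [← Finset.prod_filter_mul_prod_filter_not Finset.univ (E u), mul_comm]
          congr 1
          · refine Finset.prod_congr rfl fun r hr => ?_
            rw [lmarginal_insert _ .of_discrete hu]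
          · refine Finset.prod_congr rfl fun r hr => ?_
            rw [lmarginal_insert _ .of_discrete hu]
            have : ∀ y, (∫⋯∫⁻_T, (fun a => F r a ^ n) ∂(fun _ => μ)) (Function.update x u y)
              = K r x := hKu r (by simpa using hr) x
            simp [this]

/-- Finner's inequality for finite sums. -/
theorem sum_prod_le_prod_rpow {ι L W : Type*} [Fintype L] [DecidableEq L] [Fintype W]
    (q : W → ℝ) (hq : ∀ i, 0 ≤ q i) (hq1 : ∑ i, q i = 1)
    [Fintype ι] {n : ℕ} (hn : 0 < n) (E : L → ι → Prop) [∀ u, DecidablePred (E u)]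
    (hE : ∀ u, (Finset.univ.filter (E u)).card ≤ n) (F : ι → (L → W) → ℝ)
    (hF0 : ∀ r a, 0 ≤ F r a) (hF : ∀ r, DependsOn (F r) {u | E u r}) :
    ∑ a : L → W, (∏ u, q (a u)) * ∏ r, F r a
      ≤ ∏ r, (∑ a : L → W, (∏ u, q (a u)) * F r a ^ n) ^ (1 / n : ℝ) := by
  classical
  let _ : MeasurableSpace W := ⊤
  have : DiscreteMeasurableSpace W := ⟨fun _ => trivial⟩
  set P : PMF W := PMF.ofFintype (fun i => ENNReal.ofReal (q i)) (by
    rw [← ENNReal.ofReal_sum_of_nonneg (fun i _ => hq i), hq1, ENNReal.ofReal_one]) with hP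
  have hne : Nonempty W := by
    by_contra h
    rw [not_nonempty_iff] at h
    simp at hq1
  have key : ∀ f : (L → W) → ℝ, (∀ a, 0 ≤ f a) →
      ∫⁻ a, ENNReal.ofReal (f a) ∂(Measure.pi fun _ : L => P.toMeasure)
        = ENNReal.ofReal (∑ a : L → W, (∏ u, q (a u)) * f a) := by
    intro f hf
    rw [lintegral_fintype, ENNReal.ofReal_sum_of_nonneg
      (fun a _ => mul_nonneg (Finset.prod_nonneg fun _ _ => hq _) (hf a))]
    refine Finset.sum_congr rfl fun a _ => ?_
    rw [Measure.pi_singleton, mul_comm, ENNReal.ofReal_mul (Finset.prod_nonneg fun _ _ => hq _),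
      ENNReal.ofReal_prod_of_nonneg (fun _ _ => hq _)]
    congr 1
    refine Finset.prod_congr rfl fun u _ => ?_
    rw [PMF.toMeasure_apply_singleton _ _ (MeasurableSet.singleton _), hP, PMF.ofFintype_apply]
  have main := lmarginal_prod_le P.toMeasure hn E hE (fun r a => ENNReal.ofReal (F r a))
    (fun r x y h => by simp only [hF r h]) Finset.univ (fun _ => hne.some)
  simp only [lmarginal_univ] at main
  simp only [← ENNReal.ofReal_prod_of_nonneg (fun r _ => hF0 r _),
    ← ENNReal.ofReal_pow (hF0 _ _)] at main
  have hs : ∀ r, 0 ≤ ∑ a : L → W, (∏ u, q (a u)) * F r a ^ n := fun r =>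
    Finset.sum_nonneg fun a _ => mul_nonneg (Finset.prod_nonneg fun _ _ => hq _)
      (pow_nonneg (hF0 r a) n)
  rw [key _ (fun a => Finset.prod_nonneg fun r _ => hF0 r a)] at main
  have hk : ∀ r, (∫⁻ a, ENNReal.ofReal (F r a ^ n) ∂(Measure.pi fun _ : L => P.toMeasure))
      ^ (1 / n : ℝ) = ENNReal.ofReal ((∑ a : L → W, (∏ u, q (a u)) * F r a ^ n) ^ (1 / n : ℝ)) := by
    intro r
    rw [key _ (fun a => pow_nonneg (hF0 r a) n),
      ENNReal.ofReal_rpow_of_nonneg (hs r) (by positivity)]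
  simp only [hk] at main
  rw [← ENNReal.ofReal_prod_of_nonneg (fun r _ => Real.rpow_nonneg (hs r) _)] at main
  exact (ENNReal.ofReal_le_ofReal_iff
    (Finset.prod_nonneg fun r _ => Real.rpow_nonneg (hs r) _)).1 main

end Finner


/-! ### Moments of a single star -/

section Star

variable {L W : Type*} (H : LoopGraph W)

open Classical in
/-- The soft interaction between two colours: non-adjacent colours cost a factor `r`. -/
noncomputable def softEdge (r : ℝ) (i j : W) : ℝ := if H.Adj i j then 1 else r

theorem softEdge_nonneg {r : ℝ} (hr : 0 ≤ r) (i j : W) : 0 ≤ softEdge H r i j := by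
  unfold softEdge; split_ifs <;> simp [hr]

theorem softEdge_le_one {r : ℝ} (hr : r ≤ 1) (i j : W) : softEdge H r i j ≤ 1 := by
  unfold softEdge; split_ifs <;> simp [hr]

theorem setWeight_nonneg {lam : W → ℝ} (h : ∀ i, 0 ≤ lam i) (A : Finset W) : 0 ≤ setWeight lam A :=
  Finset.sum_nonneg fun i _ => h i

variable [Fintype W]

open Classical in
/-- The common neighbourhood of a set of colours. -/
noncomputable def commonNbrs (A : Finset W) : Finset W :=
  Finset.univ.filter fun j => ∀ i ∈ A, H.Adj i j

theorem setWeight_mul_commonNbrs_le_eta (lam : W → ℝ) (A : Finset W) :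
    setWeight lam A * setWeight lam (commonNbrs H A) ≤ eta H lam := by
  classical
  refine Finset.le_sup' (f := fun P : Finset W × Finset W => setWeight lam P.1 * setWeight lam P.2)
    (b := (A, commonNbrs H A)) ?_
  simp only [fullPairs, Finset.mem_filter, Finset.mem_univ, true_and]
  intro u hu v hv
  simp only [commonNbrs, Finset.mem_filter] at hv
  exact hv.2 u hu

theorem setWeight_le_univ {lam : W → ℝ} (h : ∀ i, 0 ≤ lam i) (A : Finset W) :
    setWeight lam A ≤ setWeight lam Finset.univ :=
  Finset.sum_le_sum_of_subset_of_nonneg (Finset.subset_univ _) fun i _ _ => h i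

/-- The factor contributed by a vertex whose neighbours `D` are coloured by `a`. -/
noncomputable def starFactor (q : W → ℝ) (r : ℝ) (D : Finset L) (a : L → W) : ℝ :=
  ∑ j, q j * ∏ u ∈ D, softEdge H r (a u) j

theorem starFactor_nonneg {q : W → ℝ} (hq : ∀ i, 0 ≤ q i) {r : ℝ} (hr : 0 ≤ r) (D : Finset L)
    (a : L → W) : 0 ≤ starFactor H q r D a :=
  Finset.sum_nonneg fun j _ => mul_nonneg (hq j)
    (Finset.prod_nonneg fun _ _ => softEdge_nonneg H hr _ _)

/-- If every colour of `A` is frequent on `D`, only the common neighbours of `A` contribute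
substantially. -/
theorem starFactor_le {q : W → ℝ} (hq : ∀ i, 0 ≤ q i) (hq1 : ∑ i, q i = 1) {r : ℝ} (hr : 0 ≤ r)
    (hr1 : r ≤ 1) (D : Finset L) (a : L → W) {x : ℝ} (hx : 0 ≤ x) (A : Finset W) [DecidableEq W]
    (hA : ∀ i ∈ A, x ≤ ((D.filter fun u => a u = i).card : ℝ)) :
    starFactor H q r D a ≤ setWeight q (commonNbrs H A) + r ^ x := by
  classical
  have h1 : ∀ j, q j * ∏ u ∈ D, softEdge H r (a u) j ≤
      (if j ∈ commonNbrs H A then q j else 0) + q j * r ^ x := by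
    intro j
    by_cases hj : j ∈ commonNbrs H A
    · rw [if_pos hj]
      have : ∏ u ∈ D, softEdge H r (a u) j ≤ 1 :=
        Finset.prod_le_one (fun _ _ => softEdge_nonneg H hr _ _)
          fun _ _ => softEdge_le_one H hr1 _ _
      have h2 := mul_le_mul_of_nonneg_left this (hq j)
      have h3 := mul_nonneg (hq j) (Real.rpow_nonneg hr x)
      linarith
    · rw [if_neg hj, zero_add]
      refine mul_le_mul_of_nonneg_left ?_ (hq j)
      -- Some colour `i ∈ A` is not adjacent to `j`, and each of the at least `x` vertices of `D`
      -- coloured `i` then costs a factor `r`.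
      simp only [commonNbrs, Finset.mem_filter, Finset.mem_univ, true_and, not_forall] at hj
      obtain ⟨i, hi, hij⟩ := hj
      calc ∏ u ∈ D, softEdge H r (a u) j
          ≤ ∏ u ∈ D, (if a u = i then r else 1) := by
            refine Finset.prod_le_prod (fun _ _ => softEdge_nonneg H hr _ _) fun u _ => ?_
            split_ifs with h
            · rw [softEdge, h, if_neg hij]
            · exact softEdge_le_one H hr1 _ _
        _ = r ^ (D.filter fun u => a u = i).card := by
            rw [Finset.prod_ite]; simp
        _ ≤ r ^ x := by
            rw [← Real.rpow_natCast]
            exact Real.rpow_le_rpow_of_exponent_ge' hr hr1 hx (hA i hi)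
  calc starFactor H q r D a ≤ ∑ j, ((if j ∈ commonNbrs H A then q j else 0) + q j * r ^ x) :=
        Finset.sum_le_sum fun j _ => h1 j
    _ = _ := by
        rw [Finset.sum_add_distrib, ← Finset.sum_mul, hq1, one_mul]
        simp [setWeight]

/-- Summing a product of functions of single coordinates against a product weight. -/
theorem sum_prod_mul_prod [Fintype L] [DecidableEq L] {q : W → ℝ} (hq1 : ∑ i, q i = 1) (D : Finset L) (h : W → ℝ) :
    ∑ a : L → W, (∏ u, q (a u)) * ∏ u ∈ D, h (a u) = (∑ i, q i * h i) ^ D.card := by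
  classical
  have : ∀ a : L → W, (∏ u, q (a u)) * ∏ u ∈ D, h (a u)
      = ∏ u, q (a u) * (if u ∈ D then h (a u) else 1) := by
    intro a
    rw [Finset.prod_mul_distrib, Finset.prod_ite_mem, Finset.univ_inter]
  simp only [this]
  rw [← Fintype.prod_sum (fun u i => q i * (if u ∈ D then h i else 1))]
  have h2 : ∀ u, (∑ i, q i * (if u ∈ D then h i else 1))
      = if u ∈ D then ∑ i, q i * h i else 1 := by
    intro u; split_ifs <;> simp [hq1]
  simp only [h2, Finset.prod_ite_mem, Finset.univ_inter, Finset.prod_const]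

/-- The `n`-th moment of the factor of a vertex with `n` neighbours. -/
theorem sum_starFactor_pow_mul_le [Fintype L] [DecidableEq L] {q : W → ℝ} (hq : ∀ i, 0 ≤ q i) (hq1 : ∑ i, q i = 1) {r : ℝ}
    (hr : 0 ≤ r) (hr1 : r ≤ 1) (D : Finset L) {z θ : ℝ} (hz : 0 < z) (hz1 : z ≤ 1) (hθ : 0 ≤ θ) :
    (∑ a : L → W, (∏ u, q (a u)) * starFactor H q r D a ^ D.card)
        * (z ^ (Fintype.card W * θ)) ^ D.card
      ≤ ∑ A : Finset W, ((setWeight q A + z) *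
          (setWeight q (commonNbrs H A) + r ^ (θ * D.card))) ^ D.card := by
  classical
  set n := D.card with hn
  set y := r ^ (θ * n) with hy
  have hy0 : 0 ≤ y := Real.rpow_nonneg hr _
  -- Each `a` is charged to the set `A` of colours used at least `θn` times on `D`. At most `|W|θn`
  -- vertices of `D` have a colour outside `A`, so the penalty product is at least `z ^ (|W|θn)`,
  -- which the factor on the left pays for. Summing over all `A` removes the dependence of `A` on
  -- `a`, and the sum over `a` factorises.
  have hpt : ∀ a : L → W, starFactor H q r D a ^ n * (z ^ (Fintype.card W * θ)) ^ n ≤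
      ∑ A : Finset W, (∏ u ∈ D, (if a u ∈ A then 1 else z)) *
        (setWeight q (commonNbrs H A) + y) ^ n := by
    intro a
    set A : Finset W := Finset.univ.filter
      fun i => θ * n ≤ ((D.filter fun u => a u = i).card : ℝ) with hA
    refine le_trans ?_ (Finset.single_le_sum (f := fun A : Finset W =>
      (∏ u ∈ D, (if a u ∈ A then 1 else z)) * (setWeight q (commonNbrs H A) + y) ^ n)
      (fun A _ => mul_nonneg (Finset.prod_nonneg fun u _ => ?_)
        (pow_nonneg (add_nonneg (setWeight_nonneg hq _) hy0) _)) (Finset.mem_univ A))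
    · rw [mul_comm]
      refine mul_le_mul ?_ (pow_le_pow_left₀ (starFactor_nonneg H hq hr D a) ?_ n)
        (pow_nonneg (starFactor_nonneg H hq hr D a) n) (Finset.prod_nonneg fun u _ => ?_)
      · rw [Finset.prod_ite, Finset.prod_const_one, one_mul, Finset.prod_const,
          ← Real.rpow_natCast, ← Real.rpow_mul hz.le, ← Real.rpow_natCast]
        refine Real.rpow_le_rpow_of_exponent_ge hz hz1 ?_
        have h1 : (D.filter fun u => a u ∉ A).card
            = ∑ i ∈ Aᶜ, (D.filter fun u => a u = i).card := by
          rw [Finset.card_eq_sum_card_fiberwise (f := a) (t := Aᶜ)]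
          · refine Finset.sum_congr rfl fun i hi => ?_
            congr 1
            ext u
            simp only [Finset.mem_filter, Finset.mem_compl] at hi ⊢
            constructor
            · rintro ⟨⟨h, _⟩, h'⟩; exact ⟨h, h'⟩
            · rintro ⟨h, rfl⟩; exact ⟨⟨h, hi⟩, rfl⟩
          · intro u hu
            simpa using (Finset.mem_filter.1 hu).2
        rw [h1, Nat.cast_sum]
        calc (∑ i ∈ Aᶜ, ((D.filter fun u => a u = i).card : ℝ)) ≤ ∑ i ∈ Aᶜ, θ * n := by
              refine Finset.sum_le_sum fun i hi => ?_
              simp only [hA, Finset.mem_compl, Finset.mem_filter, Finset.mem_univ, true_and,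
                not_le] at hi
              exact hi.le
          _ ≤ ∑ i : W, θ * n :=
              Finset.sum_le_sum_of_subset_of_nonneg (Finset.subset_univ _) fun _ _ _ => by
                positivity
          _ = _ := by simp [mul_assoc]
      · refine starFactor_le H hq hq1 hr hr1 D a (by positivity) A fun i hi => ?_
        simpa [hA] using hi
      · split_ifs <;> simp [hz.le]
    · split_ifs <;> simp [hz.le]
  calc _ = ∑ a : L → W, (∏ u, q (a u)) *
          (starFactor H q r D a ^ n * (z ^ (Fintype.card W * θ)) ^ n) := by
        rw [Finset.sum_mul]; simp only [mul_assoc]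
    _ ≤ ∑ a : L → W, (∏ u, q (a u)) * ∑ A : Finset W, (∏ u ∈ D, (if a u ∈ A then 1 else z)) *
        (setWeight q (commonNbrs H A) + y) ^ n :=
        Finset.sum_le_sum fun a _ => mul_le_mul_of_nonneg_left (hpt a)
          (Finset.prod_nonneg fun _ _ => hq _)
    _ = ∑ A : Finset W, (∑ i, q i * (if i ∈ A then 1 else z)) ^ n *
        (setWeight q (commonNbrs H A) + y) ^ n := by
        simp only [Finset.mul_sum]
        rw [Finset.sum_comm]
        refine Finset.sum_congr rfl fun A _ => ?_
        rw [← sum_prod_mul_prod hq1 D (fun i => if i ∈ A then 1 else z), Finset.sum_mul]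
        simp only [mul_assoc]
    _ ≤ _ := by
        refine Finset.sum_le_sum fun A _ => ?_
        rw [mul_pow]
        refine mul_le_mul_of_nonneg_right (pow_le_pow_left₀ (Finset.sum_nonneg fun i _ => ?_) ?_ _)
          (pow_nonneg (add_nonneg (setWeight_nonneg hq _) hy0) _)
        · have := hq i; split_ifs <;> positivity
        · calc _ ≤ ∑ i, ((if i ∈ A then q i else 0) + q i * z) := by
                refine Finset.sum_le_sum fun i _ => ?_
                have := mul_nonneg (hq i) hz.le
                split_ifs <;> linarith
            _ = _ := by
                rw [Finset.sum_add_distrib, ← Finset.sum_mul, hq1, one_mul]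
                simp [setWeight]

/-- For large degree, the `n`-th moment is at most `ξ ^ n` for any `ξ` above `η`. -/
theorem eventually_sum_starFactor_pow_le {q : W → ℝ} (hq : ∀ i, 0 ≤ q i) (hq1 : ∑ i, q i = 1)
    {ξ : ℝ} (hξ : eta H q < ξ) {f : ℕ → ℝ} (hf : Tendsto f atTop atTop) :
    ∀ᶠ n : ℕ in atTop, ∀ (L : Type*) [Fintype L] [DecidableEq L] (D : Finset L), D.card = n →
      ∀ p : ℝ, f n / n ≤ p → p ≤ 1 →
        ∑ a : L → W, (∏ u, q (a u)) * starFactor H q (1 - p) D a ^ n ≤ ξ ^ n := by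
  classical
  have heta0 : 0 ≤ eta H q :=
    (mul_nonneg (setWeight_nonneg hq _) (setWeight_nonneg hq _)).trans
      (setWeight_mul_commonNbrs_le_eta H q ∅)
  have hsw1 : ∀ A, setWeight q A ≤ 1 := fun A => (setWeight_le_univ hq A).trans_eq hq1
  obtain ⟨ξ₁, h1, h2⟩ := exists_between hξ
  -- `τ` serves both as the penalty `z` and as a bound for `(1 - p) ^ (θn)`. Since weights are at
  -- most `1`, the product `(w(A) + τ)(w(N(A)) + τ)` is at most `η + 3τ`. The factor `1 + τ` pays
  -- for `z ^ (|W|θ)` through the choice of `θ`, and the gap between `ξ₁` and `ξ` absorbs the `2 ^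
  -- |W|` choices of `A`.
  obtain ⟨τ, hτ0, hτ1, hτ⟩ : ∃ τ : ℝ, 0 < τ ∧ τ ≤ 1 ∧
      (eta H q + 3 * τ) * (1 + τ) ≤ ξ₁ := by
    have : Tendsto (fun τ : ℝ => (eta H q + 3 * τ) * (1 + τ)) (𝓝[>] 0) (𝓝 (eta H q)) := by
      have h : Continuous fun τ : ℝ => (eta H q + 3 * τ) * (1 + τ) := by fun_prop
      have := (h.tendsto 0).mono_left (nhdsWithin_le_nhds (s := Set.Ioi 0))
      simpa using this
    have h3 := this.eventually (gt_mem_nhds h1)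
    have h4 : ∀ᶠ τ : ℝ in 𝓝[>] 0, τ < 1 := nhdsWithin_le_nhds (gt_mem_nhds one_pos)
    obtain ⟨τ, a, b, c⟩ := (h3.and (h4.and self_mem_nhdsWithin)).exists
    exact ⟨τ, c, b.le, a.le⟩
  obtain ⟨θ, hθ0, hθ⟩ : ∃ θ : ℝ, 0 < θ ∧ (1 + τ)⁻¹ ≤ τ ^ (Fintype.card W * θ) := by
    have h : Continuous fun θ : ℝ => τ ^ (Fintype.card W * θ) :=
      Real.continuous_const_rpow hτ0.ne' |>.comp (by fun_prop)
    have := (h.tendsto 0).mono_left (nhdsWithin_le_nhds (s := Set.Ioi 0))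
    simp only [mul_zero, Real.rpow_zero] at this
    obtain ⟨θ, a, b⟩ := ((this.eventually (lt_mem_nhds
      (inv_lt_one_of_one_lt₀ (by linarith : 1 < 1 + τ)))).and self_mem_nhdsWithin).exists
    exact ⟨θ, b, a.le⟩
  have hfe : ∀ᶠ n in atTop, Real.exp (-(θ * f n)) ≤ τ := by
    have : Tendsto (fun n => Real.exp (-(θ * f n))) atTop (𝓝 0) :=
      Real.tendsto_exp_neg_atTop_nhds_zero.comp (hf.const_mul_atTop hθ0)
    exact (this.eventually (gt_mem_nhds hτ0)).mono fun n h => h.le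
  have hξ1 : 0 < ξ₁ := lt_of_le_of_lt heta0 h1
  have hpow : ∀ᶠ n : ℕ in atTop, 2 ^ Fintype.card W * ξ₁ ^ n ≤ ξ ^ n := by
    have h5 := tendsto_pow_atTop_atTop_of_one_lt ((one_lt_div hξ1).2 h2)
    filter_upwards [h5.eventually_ge_atTop (2 ^ Fintype.card W : ℝ)] with n hn
    rwa [div_pow, le_div_iff₀ (by positivity)] at hn
  filter_upwards [hfe, hpow, eventually_gt_atTop 0, hf.eventually_ge_atTop 0]
    with n hn1 hn2 hn0 hf0 L _ _ D hD p hp hp1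
  have hn0' : (0 : ℝ) < n := by exact_mod_cast hn0
  have hp0 : 0 ≤ p := le_trans (by positivity) hp
  have hs := sum_starFactor_pow_mul_le H hq hq1 (sub_nonneg.2 hp1) (by linarith : 1 - p ≤ 1) D
    hτ0 hτ1 hθ0.le
  rw [hD] at hs
  set S := ∑ a : L → W, (∏ u, q (a u)) * starFactor H q (1 - p) D a ^ n with hS
  have hS0 : 0 ≤ S := Finset.sum_nonneg fun a _ => mul_nonneg
    (Finset.prod_nonneg fun _ _ => hq _) (pow_nonneg (starFactor_nonneg H hq (by linarith) _ _) _)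
  have hr : (1 - p) ^ (θ * n) ≤ τ := by
    refine le_trans ?_ hn1
    calc (1 - p) ^ (θ * n) ≤ Real.exp (-p) ^ (θ * n) :=
          Real.rpow_le_rpow (by linarith) (by linarith [Real.add_one_le_exp (-p)]) (by positivity)
      _ = Real.exp (-p * (θ * n)) := by rw [← Real.exp_mul]
      _ ≤ _ := by
          rw [Real.exp_le_exp, neg_mul, neg_le_neg_iff]
          rw [div_le_iff₀ hn0'] at hp
          nlinarith
  have hA : ∀ A : Finset W, ((setWeight q A + τ) *
      (setWeight q (commonNbrs H A) + (1 - p) ^ (θ * n))) ^ n ≤ (eta H q + 3 * τ) ^ n := by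
    intro A
    have a0 := setWeight_nonneg hq A
    have b0 := setWeight_nonneg hq (commonNbrs H A)
    have a1 := hsw1 A
    have b1 := hsw1 (commonNbrs H A)
    have ab := setWeight_mul_commonNbrs_le_eta H q A
    have r0 : 0 ≤ (1 - p) ^ (θ * n) := Real.rpow_nonneg (by linarith) _
    refine pow_le_pow_left₀ (by positivity) ?_ _
    calc _ ≤ (setWeight q A + τ) * (setWeight q (commonNbrs H A) + τ) := by gcongr
      _ ≤ _ := by nlinarith
  have hK : ((1 + τ)⁻¹) ^ n ≤ (τ ^ (Fintype.card W * θ)) ^ n :=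
    pow_le_pow_left₀ (by positivity) hθ n
  have h6 : S * ((1 + τ)⁻¹) ^ n ≤ 2 ^ Fintype.card W * (eta H q + 3 * τ) ^ n := by
    calc _ ≤ S * (τ ^ (Fintype.card W * θ)) ^ n := by gcongr
      _ ≤ _ := hs
      _ ≤ ∑ A : Finset W, (eta H q + 3 * τ) ^ n := Finset.sum_le_sum fun A _ => hA A
      _ = _ := by simp
  rw [inv_pow, ← div_eq_mul_inv, div_le_iff₀ (by positivity), mul_assoc, ← mul_pow] at h6
  refine h6.trans (le_trans ?_ hn2)
  gcongr

end Star


/-! ### Percolation and the expected partition function -/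

section Percolation

variable {V : Type*} [Fintype V]

open Classical in
/-- The expectation of `X` at the percolated graph. -/
noncomputable def percExp (G : SimpleGraph V) (p : ℝ) (X : SimpleGraph V → ℝ) : ℝ :=
  ∑ T ∈ G.edgeFinset.powerset, p ^ T.card * (1 - p) ^ (G.edgeFinset.card - T.card) *
    X (SimpleGraph.fromEdgeSet (T : Set (Sym2 V)))

theorem percProb_eq_percExp (G : SimpleGraph V) (p : ℝ) (S : Set (SimpleGraph V))
    [∀ G', Decidable (G' ∈ S)] :
    percProb G p S = percExp G p (fun G' => if G' ∈ S then 1 else 0) := by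
  rw [percProb, percExp, Finset.sum_filter]
  exact Finset.sum_congr rfl fun T _ => by rw [mul_ite, mul_one, mul_zero]; congr!

theorem percExp_mono {G : SimpleGraph V} {p : ℝ} (hp : 0 ≤ p) (hp1 : p ≤ 1)
    {X Y : SimpleGraph V → ℝ} (h : ∀ G' ≤ G, X G' ≤ Y G') : percExp G p X ≤ percExp G p Y := by
  classical
  refine Finset.sum_le_sum fun T hT => mul_le_mul_of_nonneg_left (h _ ?_)
    (mul_nonneg (pow_nonneg hp _) (pow_nonneg (sub_nonneg.2 hp1) _))
  rw [Finset.mem_powerset] at hT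
  intro u v huv
  rw [SimpleGraph.fromEdgeSet_adj] at huv
  simpa using hT huv.1

theorem percExp_const (G : SimpleGraph V) (p x : ℝ) : percExp G p (fun _ => x) = x := by
  classical
  rw [percExp, ← Finset.sum_mul, Finset.sum_pow_mul_eq_add_pow]
  simp

theorem percExp_sum {ι : Type*} (s : Finset ι) (G : SimpleGraph V) (p : ℝ)
    (X : ι → SimpleGraph V → ℝ) :
    percExp G p (fun G' => ∑ i ∈ s, X i G') = ∑ i ∈ s, percExp G p (X i) := by
  simp only [percExp, Finset.mul_sum]
  exact Finset.sum_comm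

theorem percExp_add (G : SimpleGraph V) (p : ℝ) (X Y : SimpleGraph V → ℝ) :
    percExp G p (fun G' => X G' + Y G') = percExp G p X + percExp G p Y := by
  simp only [percExp, mul_add, Finset.sum_add_distrib]

theorem percExp_mul (G : SimpleGraph V) (p x : ℝ) (X : SimpleGraph V → ℝ) :
    percExp G p (fun G' => x * X G') = x * percExp G p X := by
  simp only [percExp, Finset.mul_sum]
  exact Finset.sum_congr rfl fun T _ => by ring

theorem percProb_nonneg {G : SimpleGraph V} {p : ℝ} (hp : 0 ≤ p) (hp1 : p ≤ 1)
    (S : Set (SimpleGraph V)) : 0 ≤ percProb G p S :=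
  Finset.sum_nonneg fun _ _ =>
    mul_nonneg (pow_nonneg hp _) (pow_nonneg (sub_nonneg.2 hp1) _)

theorem percProb_mono {G : SimpleGraph V} {p : ℝ} (hp : 0 ≤ p) (hp1 : p ≤ 1)
    {S S' : Set (SimpleGraph V)} (h : ∀ G' ≤ G, G' ∈ S → G' ∈ S') :
    percProb G p S ≤ percProb G p S' := by
  classical
  rw [percProb_eq_percExp, percProb_eq_percExp]
  refine percExp_mono hp hp1 fun G' hG' => ?_
  by_cases h1 : G' ∈ S
  · simp [h1, h G' hG' h1]
  · rw [if_neg h1]; split_ifs <;> simp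

/-- Markov's inequality for the percolated graph. -/
theorem one_sub_le_percProb {G : SimpleGraph V} {p : ℝ} (hp : 0 ≤ p) (hp1 : p ≤ 1)
    {X : SimpleGraph V → ℝ} (hX : ∀ G', 0 ≤ X G') {x y : ℝ} (hx : 0 < x)
    (h : percExp G p X ≤ x * y) : 1 - y ≤ percProb G p {G' | X G' ≤ x} := by
  classical
  have h1 : percExp G p (fun _ => 1) ≤ percExp G p
      (fun G' => (if G' ∈ {G' | X G' ≤ x} then 1 else 0) + x⁻¹ * X G') := by
    refine percExp_mono hp hp1 fun G' _ => ?_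
    split_ifs with h2
    · have := mul_nonneg (inv_nonneg.2 hx.le) (hX G'); linarith
    · rw [Set.mem_ofPred_eq, not_le] at h2
      rw [zero_add, ← div_eq_inv_mul, le_div_iff₀ hx]; linarith
  rw [percExp_const, percExp_add, ← percProb_eq_percExp, percExp_mul] at h1
  have : x⁻¹ * percExp G p X ≤ y := by
    rw [inv_mul_le_iff₀ hx]; exact h
  linarith

/-- The union bound for the percolated graph. -/
theorem one_sub_sum_le_percProb {ι : Type*} (s : Finset ι) {G : SimpleGraph V} {p : ℝ}
    (hp : 0 ≤ p) (hp1 : p ≤ 1) (S : ι → Set (SimpleGraph V)) (y : ι → ℝ)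
    (h : ∀ i ∈ s, 1 - y i ≤ percProb G p (S i)) :
    1 - ∑ i ∈ s, y i ≤ percProb G p {G' | ∀ i ∈ s, G' ∈ S i} := by
  classical
  have h1 : percExp G p (fun _ => 1) ≤ percExp G p
      (fun G' => (if G' ∈ {G' | ∀ i ∈ s, G' ∈ S i} then 1 else 0) +
        ∑ i ∈ s, (1 + (-1) * (if G' ∈ S i then 1 else 0))) := by
    refine percExp_mono hp hp1 fun G' _ => ?_
    have h0 : ∀ i ∈ s, (0 : ℝ) ≤ 1 + (-1) * (if G' ∈ S i then 1 else 0) := fun i _ => by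
      split_ifs <;> simp
    split_ifs with h2
    · have := Finset.sum_nonneg h0; linarith
    · simp only [Set.mem_ofPred_eq, not_forall] at h2
      obtain ⟨i, hi, hi'⟩ := h2
      have := Finset.single_le_sum h0 hi
      rw [if_neg hi'] at this
      linarith
  rw [percExp_const, percExp_add, ← percProb_eq_percExp, percExp_sum] at h1
  simp only [percExp_add, percExp_mul, percExp_const, ← percProb_eq_percExp] at h1
  have : ∑ i ∈ s, (1 + (-1) * percProb G p (S i)) ≤ ∑ i ∈ s, y i :=
    Finset.sum_le_sum fun i hi => by linarith [h i hi]
  linarith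

variable {W : Type*} [Fintype W] (H : LoopGraph W) (lam : W → ℝ)

open Classical in
/-- The edges of `G` that are not properly coloured by `c`. -/
noncomputable def badEdges (G : SimpleGraph V) (c : V → W) : Finset (Sym2 V) :=
  G.edgeFinset.filter fun e => ∃ u v, e = s(u, v) ∧ ¬ H.Adj (c u) (c v)

-- A map is a colouring of `G_p` exactly when none of its bad edges is kept, and edges are deleted
-- independently.
open Classical in
theorem percExp_mem_homs (G : SimpleGraph V) (p : ℝ) (c : V → W) :
    percExp G p (fun G' => if c ∈ homs G' H then 1 else 0) = (1 - p) ^ (badEdges H G c).card := by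
  set B := badEdges H G c with hB
  have hBE : B ⊆ G.edgeFinset := Finset.filter_subset _ _
  have hiff : ∀ T ∈ G.edgeFinset.powerset,
      (c ∈ homs (SimpleGraph.fromEdgeSet (T : Set (Sym2 V))) H ↔
        T ∈ (G.edgeFinset \ B).powerset) := by
    intro T hT
    rw [Finset.mem_powerset] at hT ⊢
    simp only [homs, Finset.mem_filter, Finset.mem_univ, true_and, SimpleGraph.fromEdgeSet_adj]
    constructor
    · intro h e he
      rw [Finset.mem_sdiff]
      refine ⟨hT he, fun hb => ?_⟩
      obtain ⟨hG, u, v, rfl, huv⟩ := Finset.mem_filter.1 hb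
      refine huv (h u v ⟨he, ?_⟩)
      rw [SimpleGraph.mem_edgeFinset, SimpleGraph.mem_edgeSet] at hG
      exact hG.ne
    · rintro h u v ⟨he, -⟩
      by_contra huv
      exact (Finset.mem_sdiff.1 (h he)).2 (Finset.mem_filter.2 ⟨hT he, u, v, rfl, huv⟩)
  rw [percExp]
  calc _ = ∑ T ∈ (G.edgeFinset \ B).powerset,
        p ^ T.card * (1 - p) ^ (G.edgeFinset.card - T.card) := by
        rw [← Finset.sum_subset (Finset.powerset_mono.2 (Finset.sdiff_subset (s := G.edgeFinset)
          (t := B)))]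
        · refine Finset.sum_congr rfl fun T hT => ?_
          rw [if_pos ((hiff T (Finset.powerset_mono.2 Finset.sdiff_subset hT)).2 hT), mul_one]
        · intro T hT hT'
          rw [if_neg (fun h => hT' ((hiff T hT).1 h)), mul_zero]
    _ = ∑ T ∈ (G.edgeFinset \ B).powerset,
        p ^ T.card * (1 - p) ^ ((G.edgeFinset \ B).card - T.card) * (1 - p) ^ B.card := by
        refine Finset.sum_congr rfl fun T hT => ?_
        rw [mul_assoc, ← pow_add]
        congr 2
        have h1 := Finset.card_le_card (Finset.mem_powerset.1 hT)
        have h2 := Finset.card_sdiff_add_card_eq_card hBE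
        omega
    _ = _ := by
        rw [← Finset.sum_mul, Finset.sum_pow_mul_eq_add_pow]; simp

-- Averaging turns the hard constraints into soft ones: a factor `1 - p` for each violated edge of
-- `G`.
open Classical in
theorem percExp_partitionFn (G : SimpleGraph V) (p : ℝ) :
    percExp G p (fun G' => partitionFn G' H lam)
      = ∑ c : V → W, colWeight lam c * (1 - p) ^ (badEdges H G c).card := by
  have : (fun G' => partitionFn G' H lam)
      = fun G' => ∑ c : V → W, colWeight lam c * (if c ∈ homs G' H then 1 else 0) := by
    funext G'
    rw [partitionFn]
    simp
  rw [this, percExp_sum]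
  refine Finset.sum_congr rfl fun c _ => ?_
  rw [percExp_mul, ← percExp_mem_homs]

/-- `G` is bipartite with parts `s` and its complement, and regular of degree `n`. -/
structure RegularBipartition (G : SimpleGraph V) (s : V → Prop) (n : ℕ) : Prop where
  adj : ∀ u v, G.Adj u v → (s u ↔ ¬ s v)
  degree : ∀ v, (G.neighborSet v).ncard = n

namespace RegularBipartition

variable {G : SimpleGraph V} {s : V → Prop} {n : ℕ}

open Classical in
theorem card_left (h : RegularBipartition G s n) (v : {v // ¬ s v}) :
    (Finset.univ.filter fun u : {u // s u} => G.Adj u v).card = n := by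
  rw [← h.degree v, ← Finset.card_map (Function.Embedding.subtype _), ← Set.ncard_coe_finset]
  congr 1
  ext u
  simp only [Finset.coe_map, Finset.coe_filter, Finset.mem_univ, true_and, Set.mem_image,
    Set.mem_ofPred_eq, SimpleGraph.mem_neighborSet]
  constructor
  · rintro ⟨u, hu, rfl⟩; exact hu.symm
  · intro hu; exact ⟨⟨u, (h.adj _ _ hu.symm).2 v.2⟩, hu.symm, rfl⟩

open Classical in
theorem card_right (h : RegularBipartition G s n) (u : {u // s u}) :
    (Finset.univ.filter fun v : {v // ¬ s v} => G.Adj u v).card = n := by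
  rw [← h.degree u, ← Finset.card_map (Function.Embedding.subtype _), ← Set.ncard_coe_finset]
  congr 1
  ext v
  simp only [Finset.coe_map, Finset.coe_filter, Finset.mem_univ, true_and, Set.mem_image,
    Set.mem_ofPred_eq, SimpleGraph.mem_neighborSet]
  constructor
  · rintro ⟨u, hu, rfl⟩; exact hu
  · intro hu; exact ⟨⟨v, (h.adj _ _ hu).1 u.2⟩, hu, rfl⟩

open Classical in
theorem card_eq (h : RegularBipartition G s n) (hn : 0 < n) :
    Fintype.card {u // s u} = Fintype.card {v // ¬ s v} := by
  have := Finset.sum_card_bipartiteAbove_eq_sum_card_bipartiteBelow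
    (s := (Finset.univ : Finset {u // s u})) (t := (Finset.univ : Finset {v // ¬ s v}))
    (fun (u : {u // s u}) (v : {v // ¬ s v}) => G.Adj u v)
  have h1 : ∀ u : {u // s u}, (Finset.univ.bipartiteAbove
      (fun (u : {u // s u}) (v : {v // ¬ s v}) => G.Adj u v) u).card = n := fun u => by
    rw [← h.card_right u]
    congr 1
  have h2 : ∀ v : {v // ¬ s v}, (Finset.univ.bipartiteBelow
      (fun (u : {u // s u}) (v : {v // ¬ s v}) => G.Adj u v) v).card = n := fun v => by
    rw [← h.card_left v]
    congr 1
  rw [Finset.sum_congr rfl fun u _ => h1 u, Finset.sum_congr rfl fun v _ => h2 v] at this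
  simp only [Finset.sum_const, smul_eq_mul, Finset.card_univ] at this
  exact Nat.eq_of_mul_eq_mul_right hn this

open Classical in
theorem card_eq_two_mul (h : RegularBipartition G s n) (hn : 0 < n) :
    Fintype.card V = 2 * Fintype.card {v // ¬ s v} := by
  have h1 := Fintype.card_subtype_compl s
  have h2 := Fintype.card_subtype_le s
  have h3 := h.card_eq hn
  omega

-- Makes the number of vertices tend to infinity with `n`, so that errors exponentially small in the
-- size of a part vanish uniformly over all graphs.
open Classical in
theorem degree_le (h : RegularBipartition G s n) (hn : 0 < n) [Nonempty V] :
    n ≤ Fintype.card {v // ¬ s v} := by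
  have h1 : 0 < Fintype.card V := Fintype.card_pos
  have h2 := h.card_eq_two_mul hn
  have h3 := h.card_eq hn
  have : 0 < Fintype.card {u // s u} := by omega
  obtain ⟨u⟩ := Fintype.card_pos_iff.1 this
  rw [← h.card_right u]
  exact Finset.card_le_univ _

-- Each edge has exactly one endpoint in `s`, so bad edges correspond one to one to bad pairs of a
-- vertex outside `s` and a neighbour in `s`.
omit [Fintype W] in
open Classical in
theorem pow_card_badEdges (h : RegularBipartition G s n) (r : ℝ) (c : V → W) :
    r ^ (badEdges H G c).card = ∏ v : {v // ¬ s v},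
      ∏ u ∈ Finset.univ.filter (fun u : {u // s u} => G.Adj u v), softEdge H r (c u) (c v) := by
  have h1 : badEdges H G c = (Finset.univ.filter
      fun x : {v // ¬ s v} × {u // s u} => G.Adj x.2 x.1 ∧ ¬ H.Adj (c x.2) (c x.1)).image
        fun x => s(x.2.1, x.1.1) := by
    ext e
    simp only [badEdges, Finset.mem_filter, Finset.mem_image, Finset.mem_univ, true_and,
      SimpleGraph.mem_edgeFinset]
    constructor
    · rintro ⟨he, u, v, rfl, huv⟩
      rw [SimpleGraph.mem_edgeSet] at he
      by_cases hu : s u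
      · exact ⟨(⟨v, (h.adj _ _ he).1 hu⟩, ⟨u, hu⟩), ⟨he, huv⟩, rfl⟩
      · have hv : s v := by_contra fun hv => hu ((h.adj _ _ he).2 hv)
        exact ⟨(⟨u, hu⟩, ⟨v, hv⟩), ⟨he.symm, fun h' => huv (H.symm _ _ h')⟩, Sym2.eq_swap⟩
    · rintro ⟨x, ⟨h1, h2⟩, rfl⟩
      exact ⟨h1, _, _, rfl, h2⟩
  rw [h1, Finset.card_image_of_injective]
  · simp only [softEdge, Finset.prod_filter]
    rw [← Fintype.prod_prod_type' (f := fun (v : {v // ¬ s v}) (u : {u // s u}) =>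
      if G.Adj u v then (if H.Adj (c u) (c v) then 1 else r) else 1), ← Finset.prod_const,
      Finset.prod_filter]
    refine Finset.prod_congr rfl fun x _ => ?_
    by_cases a : G.Adj x.2 x.1 <;> by_cases b : H.Adj (c x.2) (c x.1) <;> simp [a, b]
  · rintro ⟨⟨v, hv⟩, ⟨u, hu⟩⟩ ⟨⟨v', hv'⟩, ⟨u', hu'⟩⟩ he
    simp only [Sym2.eq_iff] at he
    rcases he with ⟨rfl, rfl⟩ | ⟨rfl, rfl⟩
    · rfl
    · exact absurd hu hv'

-- Once the colours `a` on `s` are fixed, the vertices outside `s` do not interact, so the sum over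
-- their colours is a product of star factors.
open Classical in
theorem sum_colWeight_mul_pow (h : RegularBipartition G s n) (q : W → ℝ) (r : ℝ) :
    ∑ c : V → W, colWeight q c * r ^ (badEdges H G c).card
      = ∑ a : {u // s u} → W, (∏ u, q (a u)) * ∏ v : {v // ¬ s v},
        starFactor H q r (Finset.univ.filter fun u : {u // s u} => G.Adj u v) a := by
  rw [← (Equiv.piEquivPiSubtypeProd s (fun _ => W)).symm.sum_comp, Fintype.sum_prod_type]
  refine Finset.sum_congr rfl fun a _ => ?_
  simp only [starFactor]
  rw [Fintype.prod_sum, Finset.mul_sum]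
  refine Finset.sum_congr rfl fun b _ => ?_
  rw [h.pow_card_badEdges, colWeight, ← Fintype.prod_subtype_mul_prod_subtype s, mul_assoc,
    Finset.prod_mul_distrib]
  congr 1
  · refine Finset.prod_congr rfl fun u _ => ?_
    simp [Equiv.piEquivPiSubtypeProd, u.2]
  congr 1
  · refine Finset.prod_congr rfl fun u _ => ?_
    simp [Equiv.piEquivPiSubtypeProd, u.2]
  · refine Finset.prod_congr rfl fun v _ => Finset.prod_congr rfl fun u _ => ?_
    simp [Equiv.piEquivPiSubtypeProd, u.2, v.2]

end RegularBipartition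

/-- Allows passing to probability weights, which Finner's inequality needs. -/
theorem eta_div_le {w : ℝ} (hw : 0 < w) :
    eta H (fun i => lam i / w) ≤ eta H lam / w ^ 2 := by
  refine Finset.sup'_le _ _ fun P hP => ?_
  have := Finset.le_sup' (fun P : Finset W × Finset W => setWeight lam P.1 * setWeight lam P.2) hP
  have h2 : ∀ A, setWeight (fun i => lam i / w) A = setWeight lam A / w := fun A => by
    rw [setWeight, setWeight, Finset.sum_div]
  rw [h2, h2, div_mul_div_comm, ← sq]
  exact div_le_div_of_nonneg_right this (by positivity)

variable {H lam} in
theorem eta_pos (hH : ∃ i j, H.Adj i j) (hlam : ∀ i, 0 < lam i) : 0 < eta H lam := by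
  obtain ⟨i, j, hij⟩ := hH
  refine lt_of_lt_of_le (mul_pos (hlam i) ?_)
    (by simpa [setWeight] using setWeight_mul_commonNbrs_le_eta H lam {i})
  exact Finset.sum_pos (fun k _ => hlam k) ⟨j, by simpa [commonNbrs] using hij⟩

variable {H lam} in
/-- The expected partition function of the percolated graph is close to `η ^ m`, where `m` is
the size of a part. -/
theorem eventually_percExp_partitionFn_le (hH : ∃ i j, H.Adj i j) (hlam : ∀ i, 0 < lam i)
    {δ : ℝ} (hδ : 0 < δ) {f : ℕ → ℝ} (hf : Tendsto f atTop atTop) :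
    ∀ᶠ n : ℕ in atTop, ∀ (V : Type*) [Fintype V] (G : SimpleGraph V) (s : V → Prop) (m : ℕ),
      RegularBipartition G s n → Fintype.card V = 2 * m →
      ∀ p : ℝ, f n / n ≤ p → p ≤ 1 →
        percExp G p (fun G' => partitionFn G' H lam) ≤ (eta H lam * Real.exp δ) ^ m := by
  classical
  set w := setWeight lam Finset.univ with hw
  have hw0 : 0 < w := Finset.sum_pos (fun i _ => hlam i) (by
    obtain ⟨i, -⟩ := hH; exact ⟨i, Finset.mem_univ _⟩)
  set q : W → ℝ := fun i => lam i / w with hq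
  have hq0 : ∀ i, 0 ≤ q i := fun i => (div_pos (hlam i) hw0).le
  have hq1 : ∑ i, q i = 1 := by
    rw [hq, ← Finset.sum_div]; exact div_self hw0.ne'
  set ξ := eta H lam / w ^ 2 * Real.exp δ with hξ
  have hξ0 : 0 < ξ := by have := eta_pos hH hlam; positivity
  have hξ1 : eta H q < ξ := by
    refine (eta_div_le H lam hw0).trans_lt ?_
    have := eta_pos hH hlam
    exact lt_mul_of_one_lt_right (by positivity) (Real.one_lt_exp_iff.2 hδ)
  filter_upwards [eventually_sum_starFactor_pow_le H hq0 hq1 hξ1 hf, eventually_gt_atTop 0]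
    with n hn hn0 V _ G s m h hm p hp hp1
  have hn' : (n : ℝ) ≠ 0 := by positivity
  have hmR : Fintype.card {v // ¬ s v} = m := by
    have := h.card_eq_two_mul hn0; omega
  have hcw : ∀ c : V → W, colWeight lam c = (w ^ 2) ^ m * colWeight q c := by
    intro c
    rw [colWeight, colWeight, ← pow_mul, ← hm, ← Finset.card_univ, ← Finset.prod_const,
      ← Finset.prod_mul_distrib]
    exact Finset.prod_congr rfl fun v _ => by rw [hq]; field_simp
  rw [percExp_partitionFn]
  simp only [hcw, mul_assoc]
  rw [← Finset.mul_sum, h.sum_colWeight_mul_pow]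
  have hr : 0 ≤ 1 - p := sub_nonneg.2 hp1
  -- The coordinates are the vertices of `s`, the functions are the stars centred outside `s`.
  -- Regularity is used twice: a coordinate lies in `n` stars, and (in `h4`) each star has `n`
  -- leaves, so the exponent fits the moment estimate.
  have h3 := sum_prod_le_prod_rpow q hq0 hq1 hn0
    (fun (u : {u // s u}) (v : {v // ¬ s v}) => G.Adj u v) (fun u => (h.card_right u).le)
    (fun v => starFactor H q (1 - p) (Finset.univ.filter fun u : {u // s u} => G.Adj u v))
    (fun v a => starFactor_nonneg H hq0 hr _ a) (fun v x y hxy => by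
      refine Finset.sum_congr rfl fun j _ => ?_
      congr 1
      refine Finset.prod_congr rfl fun u hu => ?_
      rw [hxy u (by simpa using hu)])
  have h4 : ∀ v : {v // ¬ s v}, (∑ a : {u // s u} → W, (∏ u, q (a u)) *
      starFactor H q (1 - p) (Finset.univ.filter fun u : {u // s u} => G.Adj u v) a ^ n)
        ^ (1 / n : ℝ) ≤ ξ := by
    intro v
    have h5 := hn {u // s u} (Finset.univ.filter fun u : {u // s u} => G.Adj u v)
      (h.card_left v) p hp hp1
    refine (Real.rpow_le_rpow (Finset.sum_nonneg fun a _ => mul_nonneg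
      (Finset.prod_nonneg fun _ _ => hq0 _) (pow_nonneg (starFactor_nonneg H hq0 hr _ a) _))
        h5 (by positivity)).trans_eq ?_
    rw [← Real.rpow_natCast, ← Real.rpow_mul hξ0.le, mul_one_div_cancel hn', Real.rpow_one]
  have h6 : ∏ v : {v // ¬ s v}, (∑ a : {u // s u} → W, (∏ u, q (a u)) *
      starFactor H q (1 - p) (Finset.univ.filter fun u : {u // s u} => G.Adj u v) a ^ n)
        ^ (1 / n : ℝ) ≤ ξ ^ m := by
    refine (Finset.prod_le_prod (fun v _ => Real.rpow_nonneg (Finset.sum_nonneg fun a _ =>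
      mul_nonneg (Finset.prod_nonneg fun _ _ => hq0 _)
        (pow_nonneg (starFactor_nonneg H hq0 hr _ a) _)) _) fun v _ => h4 v).trans_eq ?_
    rw [Finset.prod_const, Finset.card_univ, hmR]
  calc _ ≤ (w ^ 2) ^ m * ξ ^ m := by
        refine mul_le_mul_of_nonneg_left (h3.trans h6) (by positivity)
    _ = _ := by
        rw [← mul_pow, hξ]; congr 1; field_simp

end Percolation


/-! ### The random colouring, tilted weights and Chernoff bounds -/

section Colouring

variable {V W : Type*} [Fintype V] [Fintype W] {G : SimpleGraph V} {H : LoopGraph W}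
  {lam : W → ℝ}

omit [Fintype W] in
theorem colWeight_pos (hlam : ∀ i, 0 < lam i) (c : V → W) : 0 < colWeight lam c :=
  Finset.prod_pos fun _ _ => hlam _

/-- The expectation of `X` at the random colouring. -/
noncomputable def colExp (G : SimpleGraph V) (H : LoopGraph W) (lam : W → ℝ)
    (X : (V → W) → ℝ) : ℝ :=
  ∑ c ∈ homs G H, colWeight lam c / partitionFn G H lam * X c

theorem colProb_eq_colExp (S : Set (V → W)) [∀ c, Decidable (c ∈ S)] :
    colProb G H lam S = colExp G H lam (fun c => if c ∈ S then 1 else 0) := by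
  rw [colProb, colExp, Finset.sum_filter]
  exact Finset.sum_congr rfl fun T _ => by rw [mul_ite, mul_one, mul_zero]; congr!

theorem partitionFn_nonneg (hlam : ∀ i, 0 < lam i) : 0 ≤ partitionFn G H lam :=
  Finset.sum_nonneg fun _ _ => (colWeight_pos hlam _).le

theorem colExp_mono (hlam : ∀ i, 0 < lam i) {X Y : (V → W) → ℝ}
    (h : ∀ c ∈ homs G H, X c ≤ Y c) : colExp G H lam X ≤ colExp G H lam Y :=
  Finset.sum_le_sum fun c hc => mul_le_mul_of_nonneg_left (h c hc)
    (div_nonneg (colWeight_pos hlam c).le (partitionFn_nonneg hlam))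

theorem colExp_const (hZ : 0 < partitionFn G H lam) (x : ℝ) :
    colExp G H lam (fun _ => x) = x := by
  rw [colExp, ← Finset.sum_mul, ← Finset.sum_div]
  change partitionFn G H lam / _ * x = x
  rw [div_self hZ.ne', one_mul]

theorem colExp_add (X Y : (V → W) → ℝ) :
    colExp G H lam (fun c => X c + Y c) = colExp G H lam X + colExp G H lam Y := by
  simp only [colExp, mul_add, Finset.sum_add_distrib]

theorem colExp_mul (x : ℝ) (X : (V → W) → ℝ) :
    colExp G H lam (fun c => x * X c) = x * colExp G H lam X := by
  simp only [colExp, Finset.mul_sum]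
  exact Finset.sum_congr rfl fun T _ => by ring

theorem colExp_sum {ι : Type*} (s : Finset ι) (X : ι → (V → W) → ℝ) :
    colExp G H lam (fun c => ∑ i ∈ s, X i c) = ∑ i ∈ s, colExp G H lam (X i) := by
  simp only [colExp, Finset.mul_sum]
  exact Finset.sum_comm

theorem colProb_mono (hlam : ∀ i, 0 < lam i) {S S' : Set (V → W)} (h : S ⊆ S') :
    colProb G H lam S ≤ colProb G H lam S' := by
  classical
  rw [colProb_eq_colExp, colProb_eq_colExp]
  refine colExp_mono hlam fun c _ => ?_
  by_cases h1 : c ∈ S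
  · simp [h1, h h1]
  · rw [if_neg h1]; split_ifs <;> simp

theorem colProb_union_le (hlam : ∀ i, 0 < lam i) (S S' : Set (V → W)) :
    colProb G H lam (S ∪ S') ≤ colProb G H lam S + colProb G H lam S' := by
  classical
  rw [colProb_eq_colExp, colProb_eq_colExp, colProb_eq_colExp, ← colExp_add]
  refine colExp_mono hlam fun c _ => ?_
  by_cases h1 : c ∈ S <;> by_cases h2 : c ∈ S' <;> simp [h1, h2]

theorem colProb_compl (hZ : 0 < partitionFn G H lam) (S : Set (V → W)) :
    colProb G H lam Sᶜ = 1 - colProb G H lam S := by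
  classical
  rw [eq_sub_iff_add_eq, colProb_eq_colExp, colProb_eq_colExp, ← colExp_add]
  refine Eq.trans ?_ (colExp_const (H := H) (G := G) hZ 1)
  congr 1
  funext c
  by_cases h1 : c ∈ S <;> simp [h1]

/-- Markov's inequality for the random colouring. -/
theorem colProb_le_colExp_div (hlam : ∀ i, 0 < lam i) {X : (V → W) → ℝ} (hX : ∀ c, 0 ≤ X c)
    {x : ℝ} (hx : 0 < x) : colProb G H lam {c | x ≤ X c} ≤ colExp G H lam X / x := by
  classical
  rw [colProb_eq_colExp, div_eq_inv_mul, ← colExp_mul]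
  refine colExp_mono hlam fun c _ => ?_
  split_ifs with h
  · rw [← div_eq_inv_mul, le_div_iff₀ hx, one_mul]; exact h
  · exact mul_nonneg (inv_nonneg.2 hx.le) (hX c)

omit [Fintype W] in
theorem proportion_nonneg (k : W) (c : V → W) : 0 ≤ proportion k c := by
  unfold proportion; positivity

omit [Fintype W] in
theorem proportion_le_one (k : W) (c : V → W) : proportion k c ≤ 1 := by
  unfold proportion
  exact div_le_one_of_le₀ (by exact_mod_cast Finset.card_le_univ _) (by positivity)

theorem meanProportion_eq_colExp (k : W) :
    meanProportion G H lam k = colExp G H lam (proportion k) := by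
  classical
  have : proportion k = fun c : V → W =>
      1 / (Fintype.card V : ℝ) * ∑ v, (if c ∈ {c : V → W | c v = k} then 1 else 0) := by
    funext c
    simp only [Set.mem_ofPred_eq, Finset.sum_boole, proportion]
    rw [div_mul_eq_mul_div, one_mul]
  rw [this, colExp_mul, colExp_sum, meanProportion]
  simp only [colProb_eq_colExp]

open Classical in
/-- The weights with that of `k` multiplied by `e ^ x`. -/
noncomputable def tilt (lam : W → ℝ) (k : W) (x : ℝ) (i : W) : ℝ :=
  lam i * (if i = k then Real.exp x else 1)

omit [Fintype W] in
theorem tilt_pos (hlam : ∀ i, 0 < lam i) (k : W) (x : ℝ) (i : W) : 0 < tilt lam k x i := by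
  unfold tilt
  have := hlam i
  split_ifs <;> positivity

open Classical in
omit [Fintype W] in
theorem setWeight_tilt (k : W) (x : ℝ) (A : Finset W) :
    setWeight (tilt lam k x) A
      = setWeight lam A + lam k * (if k ∈ A then 1 else 0) * (Real.exp x - 1) := by
  have : ∀ i, tilt lam k x i = lam i + (if i = k then lam k * (Real.exp x - 1) else 0) := by
    intro i
    rw [tilt]
    split_ifs with h
    · subst h; ring
    · ring
  simp only [setWeight, this, Finset.sum_add_distrib, Finset.sum_ite_eq']
  split_ifs <;> ring

/-- The one-sided derivative of `log η` in the direction of `k` is governed by the pairs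
attaining `η`. -/
theorem eventually_eta_tilt_le (hη : 0 < eta H lam) (k : W) (σ : ℝ) {b : ℝ}
    (hb : ∀ P ∈ maxPairs H lam, σ * pairValue lam k P ≤ b * eta H lam) {ε : ℝ} (hε : 0 < ε) :
    ∀ᶠ t in 𝓝[>] 0, eta H (tilt lam k (σ * t)) ≤ eta H lam * Real.exp (t * (b + ε)) := by
  classical
  have key : ∀ᶠ t in 𝓝[>] (0 : ℝ), ∀ P ∈ fullPairs H,
      setWeight (tilt lam k (σ * t)) P.1 * setWeight (tilt lam k (σ * t)) P.2
        ≤ eta H lam * Real.exp (t * (b + ε)) := by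
    rw [Filter.eventually_all_finset]
    intro P hP
    simp only [setWeight_tilt]
    set x := setWeight lam P.1
    set y := setWeight lam P.2
    set x' := lam k * (if k ∈ P.1 then (1 : ℝ) else 0) with hx'
    set y' := lam k * (if k ∈ P.2 then (1 : ℝ) else 0) with hy'
    have hd : HasDerivAt (fun t => Real.exp (σ * t) - 1) σ 0 := by
      have := (((hasDerivAt_id (0 : ℝ)).const_mul σ).exp).sub_const 1
      simpa using this
    have hd1 : HasDerivAt (fun t => (x + x' * (Real.exp (σ * t) - 1)) *
        (y + y' * (Real.exp (σ * t) - 1))) (σ * (x * y' + y * x')) 0 := by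
      have := ((hd.const_mul x').const_add x).fun_mul ((hd.const_mul y').const_add y)
      refine this.congr_deriv ?_
      simp; ring
    have hd2 : HasDerivAt (fun t => eta H lam * Real.exp (t * (b + ε)))
        (eta H lam * (b + ε)) 0 := by
      have := (((hasDerivAt_id (0 : ℝ)).mul_const (b + ε)).exp).const_mul (eta H lam)
      simpa using this
    have hle : x * y ≤ eta H lam := Finset.le_sup' (fun P : Finset W × Finset W =>
      setWeight lam P.1 * setWeight lam P.2) hP
    -- A pair that is not optimal stays below by continuity. For an optimal pair both sides agree at
    -- `t = 0` and their derivatives there are compared: `σ * pairValue lam k P` against `η (b +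
    -- ε)`.
    rcases hle.lt_or_eq with hlt | heq
    · have h1 := hd1.continuousAt.tendsto.mono_left (nhdsWithin_le_nhds (s := Set.Ioi 0))
      have h2 := hd2.continuousAt.tendsto.mono_left (nhdsWithin_le_nhds (s := Set.Ioi 0))
      refine (h1.eventually_lt h2 (by simpa using hlt)).mono fun t ht => ht.le
    · have hP' : P ∈ maxPairs H lam := by
        simp only [maxPairs, Finset.mem_filter]; exact ⟨hP, heq⟩
      have h1 := hb P hP'
      have h2 : pairValue lam k P = x * y' + y * x' := by
        simp only [pairValue, hx', hy']; ring
      rw [h2] at h1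
      have hd3 := hd2.sub hd1
      have h3 := (hasDerivAt_iff_tendsto_slope.1 hd3).mono_left
        (nhdsWithin_mono (0 : ℝ) (show Set.Ioi (0 : ℝ) ⊆ {0}ᶜ from fun t ht => ht.ne'))
      have h4 : 0 < eta H lam * (b + ε) - σ * (x * y' + y * x') := by nlinarith
      filter_upwards [h3.eventually (lt_mem_nhds h4), self_mem_nhdsWithin] with t ht ht0
      rw [slope_def_field] at ht
      simp only [Pi.sub_apply, mul_zero, zero_mul, Real.exp_zero, sub_self, add_zero, mul_one,
        heq, sub_zero] at ht
      have ht0' : (0 : ℝ) < t := ht0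
      rw [lt_div_iff₀ ht0', zero_mul] at ht
      linarith
  refine key.mono fun t ht => Finset.sup'_le _ _ ht

omit [Fintype W] in
theorem colWeight_tilt (k : W) (t σ : ℝ) (c : V → W) [Nonempty V] :
    colWeight (tilt lam k (σ * t)) c
      = colWeight lam c * Real.exp (t * Fintype.card V * (σ * proportion k c)) := by
  classical
  have hV : (Fintype.card V : ℝ) ≠ 0 := by simp
  have h1 : t * Fintype.card V * (σ * proportion k c)
      = (Finset.univ.filter fun v => c v = k).card * (σ * t) := by
    rw [proportion]; field_simp
  simp only [colWeight, tilt, Finset.prod_mul_distrib]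
  rw [h1, Real.exp_nat_mul, Finset.prod_ite, Finset.prod_const, Finset.prod_const_one, mul_one]

/-- Chernoff's bound: the exponential moment of `σ * proportion k c` at scale `t|V|` is the ratio of
the tilted to the original partition function. -/
theorem colProb_tail_le (hlam : ∀ i, 0 < lam i) (k : W) {t : ℝ} (ht : 0 < t) (σ x : ℝ)
    [Nonempty V] : colProb G H lam {c | x ≤ σ * proportion k c}
      ≤ partitionFn G H (tilt lam k (σ * t)) / partitionFn G H lam
        / Real.exp (t * Fintype.card V * x) := by
  have hV : (0 : ℝ) < Fintype.card V := by exact_mod_cast Fintype.card_pos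
  have h := colProb_le_colExp_div (G := G) (H := H) hlam
    (X := fun c => Real.exp (t * Fintype.card V * (σ * proportion k c)))
    (fun _ => (Real.exp_pos _).le) (Real.exp_pos (t * Fintype.card V * x))
  have h1 : {c : V → W | x ≤ σ * proportion k c} = {c | Real.exp (t * Fintype.card V * x) ≤
      Real.exp (t * Fintype.card V * (σ * proportion k c))} := by
    ext c
    simp only [Set.mem_ofPred_eq, Real.exp_le_exp]
    rw [mul_le_mul_iff_right₀ (by positivity)]
  rw [h1]
  refine h.trans_eq ?_
  congr 1
  rw [colExp, partitionFn.eq_1 (lam := tilt lam k (σ * t)), Finset.sum_div]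
  exact Finset.sum_congr rfl fun c _ => by rw [colWeight_tilt]; ring

/-- For an optimal pair `(A, B)`, every map sending `s` into `A` and its complement into `B` is a
colouring of `G`, hence of each subgraph; these maps have total weight `(w(A) w(B)) ^ m`. -/
theorem RegularBipartition.eta_pow_le_partitionFn {s : V → Prop} {n : ℕ} {G' : SimpleGraph V}
    (h : RegularBipartition G s n) (hn : 0 < n) (hG' : G' ≤ G) (hlam : ∀ i, 0 < lam i) {m : ℕ}
    (hm : Fintype.card V = 2 * m) : eta H lam ^ m ≤ partitionFn G' H lam := by
  classical
  have h2 : Fintype.card {v // ¬ s v} = m := by have := h.card_eq_two_mul hn; omega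
  have h1 : Fintype.card {v // s v} = m := (h.card_eq hn).trans h2
  obtain ⟨P, hP⟩ := maxPairs_nonempty H lam
  simp only [maxPairs, fullPairs, Finset.mem_filter, Finset.mem_univ, true_and] at hP
  obtain ⟨hf, hP⟩ := hP
  set T : V → Finset W := fun v => if s v then P.1 else P.2 with hT
  have h3 : eta H lam ^ m = ∑ c ∈ Fintype.piFinset T, colWeight lam c := by
    simp only [colWeight]
    rw [← Finset.prod_univ_sum, ← Fintype.prod_subtype_mul_prod_subtype s]
    rw [Finset.prod_congr rfl (g := fun _ => setWeight lam P.1) fun v _ => by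
        simp [hT, v.2, setWeight],
      Finset.prod_congr rfl (s₁ := (Finset.univ : Finset {v // ¬ s v}))
        (g := fun _ => setWeight lam P.2) fun v _ => by simp [hT, v.2, setWeight]]
    simp only [Finset.prod_const, Finset.card_univ, h1, h2]
    rw [← mul_pow, hP]
  rw [h3]
  refine Finset.sum_le_sum_of_subset_of_nonneg ?_ fun c _ _ => (colWeight_pos hlam c).le
  intro c hc
  rw [Fintype.mem_piFinset] at hc
  simp only [homs, Finset.mem_filter, Finset.mem_univ, true_and]
  intro u v huv
  have hs := h.adj u v (hG' huv)
  have hu := hc u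
  have hv := hc v
  by_cases hsu : s u
  · rw [hT] at hu hv
    simp only [hsu, hs.1 hsu, if_true, if_false] at hu hv
    exact hf _ hu _ hv
  · have hsv : s v := by_contra fun hv => hsu (hs.2 hv)
    rw [hT] at hu hv
    simp only [hsu, hsv, if_true, if_false] at hu hv
    exact H.symm _ _ (hf _ hv _ hu)

/-- One bound for both tails, with `σ = 1` or `σ = -1`. The threshold has `b / 2` because partition
functions grow like `η ^ m` while `|V| = 2m`. -/
theorem eventually_colProb_tail_le (hH : ∃ i j, H.Adj i j) (hlam : ∀ i, 0 < lam i) (k : W)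
    (σ : ℝ) {b : ℝ} (hb : ∀ P ∈ maxPairs H lam, σ * pairValue lam k P ≤ b * eta H lam)
    {ε ρ : ℝ} (hε : 0 < ε) (hρ : 0 < ρ) {f : ℕ → ℝ} (hf : Tendsto f atTop atTop) :
    ∀ᶠ n : ℕ in atTop, ∀ (V : Type*) [Fintype V] [Nonempty V] (G : SimpleGraph V)
      (s : V → Prop), RegularBipartition G s n → ∀ p : ℝ, 0 ≤ p → f n / n ≤ p → p ≤ 1 →
        1 - ρ ≤ percProb G p {G' |
          colProb G' H lam {c | b / 2 + ε ≤ σ * proportion k c} ≤ ρ} := by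
  classical
  have hη := eta_pos hH hlam
  obtain ⟨t, ht, ht0⟩ :=
    ((eventually_eta_tilt_le hη k σ hb hε).and self_mem_nhdsWithin).exists
  have ht0' : (0 : ℝ) < t := ht0
  set lam' := tilt lam k (σ * t) with hlam'
  have hlam'0 : ∀ i, 0 < lam' i := tilt_pos hlam k _
  have hη' := eta_pos hH hlam'0
  -- The Chernoff exponent `2mt(b/2 + ε)` exceeds the growth `mt(b + ε)` of the tilted `η ^ m` by
  -- `mtε = 4δm`. One `δm` goes to the bound on the expectation and one to Markov's inequality; what
  -- is left covers the final `e^(-δm)`.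
  set δ := t * ε / 4 with hδ
  have hδ0 : 0 < δ := by positivity
  have hlim : ∀ᶠ n : ℕ in atTop, Real.exp (-(δ * n)) ≤ ρ := by
    have : Tendsto (fun n : ℕ => Real.exp (-(δ * n))) atTop (𝓝 0) :=
      Real.tendsto_exp_neg_atTop_nhds_zero.comp
        (tendsto_natCast_atTop_atTop.const_mul_atTop hδ0)
    exact (this.eventually (gt_mem_nhds hρ)).mono fun n h => h.le
  filter_upwards [eventually_percExp_partitionFn_le hH hlam'0 hδ0 hf, eventually_gt_atTop 0, hlim]
    with n hn hn0 hexp V _ _ G s h p hp0 hp hp1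
  set m := Fintype.card {v // ¬ s v} with hm
  have hV : Fintype.card V = 2 * m := h.card_eq_two_mul hn0
  have hnm : n ≤ m := h.degree_le hn0
  have hexp' : Real.exp (-(δ * m)) ≤ ρ := by
    refine le_trans (Real.exp_le_exp.2 ?_) hexp
    have : (n : ℝ) ≤ m := by exact_mod_cast hnm
    nlinarith
  have h1 := hn V G s m h hV p hp hp1
  have h2 := one_sub_le_percProb (y := Real.exp (-(δ * m)))
    (x := (eta H lam' * Real.exp (2 * δ)) ^ m) hp0 hp1
    (X := fun G' => partitionFn G' H lam') (fun G' => partitionFn_nonneg hlam'0) (by positivity)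
    (h1.trans_eq (by
      rw [mul_pow, mul_pow, mul_assoc, ← Real.exp_nat_mul, ← Real.exp_nat_mul, ← Real.exp_add]
      congr 2; ring))
  refine le_trans (by linarith) (h2.trans (percProb_mono hp0 hp1 fun G' hG' hZ => ?_))
  rw [Set.mem_ofPred_eq] at hZ ⊢
  have hZ0 := h.eta_pow_le_partitionFn (H := H) hn0 hG' hlam hV
  refine (colProb_tail_le hlam k ht0' σ _).trans ?_
  rw [hV]
  refine le_trans ?_ hexp'
  rw [div_le_iff₀ (Real.exp_pos _), div_le_iff₀ (lt_of_lt_of_le (by positivity) hZ0)]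
  calc partitionFn G' H lam' ≤ (eta H lam' * Real.exp (2 * δ)) ^ m := hZ
    _ ≤ (eta H lam * Real.exp (t * (b + ε)) * Real.exp (2 * δ)) ^ m := by gcongr
    _ = Real.exp (m * (t * (b + ε) + 2 * δ)) * eta H lam ^ m := by
        rw [mul_assoc, mul_pow, ← Real.exp_add, ← Real.exp_nat_mul]; ring
    _ ≤ Real.exp (-(δ * m)) * Real.exp (t * (2 * m : ℕ) * (b / 2 + ε))
          * partitionFn G' H lam := by
        rw [← Real.exp_add]
        gcongr
        push_cast
        rw [hδ]
        have : 0 ≤ (m : ℝ) * (t * ε) := by positivity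
        nlinarith

end Colouring


/-! ### The dense regime -/

section Dense

variable {W : Type*} [Fintype W] {H : LoopGraph W} {lam : W → ℝ}

omit [Fintype W] in
theorem pairValue_nonneg (hlam : ∀ i, 0 < lam i) (k : W) (P : Finset W × Finset W) :
    0 ≤ pairValue lam k P := by
  have h1 := setWeight_nonneg (fun i => (hlam i).le) P.1
  have h2 := setWeight_nonneg (fun i => (hlam i).le) P.2
  have h3 := (hlam k).le
  unfold pairValue
  split_ifs <;> positivity

theorem pairValue_le (hlam : ∀ i, 0 < lam i) (k : W) {P : Finset W × Finset W}
    (hP : P ∈ maxPairs H lam) : pairValue lam k P ≤ 2 * eta H lam := by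
  classical
  simp only [maxPairs, Finset.mem_filter] at hP
  have h1 := setWeight_nonneg (fun i => (hlam i).le) P.1
  have h2 := setWeight_nonneg (fun i => (hlam i).le) P.2
  have h3 : ∀ A : Finset W, lam k * (if k ∈ A then 1 else 0) ≤ setWeight lam A := by
    intro A
    split_ifs with h
    · rw [mul_one]; exact Finset.single_le_sum (fun i _ => (hlam i).le) h
    · rw [mul_zero]; exact setWeight_nonneg (fun i => (hlam i).le) A
  have h4 := mul_le_mul_of_nonneg_left (h3 P.2) h1
  have h5 := mul_le_mul_of_nonneg_left (h3 P.1) h2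
  rw [pairValue, mul_assoc, mul_assoc, ← hP.2]
  linarith

theorem pairValue_le_aPlus (hη : 0 < eta H lam) (k : W) {P : Finset W × Finset W}
    (hP : P ∈ maxPairs H lam) : pairValue lam k P ≤ 2 * aPlus H lam k * eta H lam := by
  have h := Finset.le_sup' (pairValue lam k) hP
  rw [aPlus]
  refine h.trans_eq ?_
  field_simp

theorem aMinus_le_pairValue (hη : 0 < eta H lam) (k : W) {P : Finset W × Finset W}
    (hP : P ∈ maxPairs H lam) : 2 * aMinus H lam k * eta H lam ≤ pairValue lam k P := by
  have h := Finset.inf'_le (pairValue lam k) hP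
  rw [aMinus]
  refine le_of_eq_of_le ?_ h
  field_simp

theorem aPlus_nonneg (hη : 0 < eta H lam) (hlam : ∀ i, 0 < lam i) (k : W) :
    0 ≤ aPlus H lam k := by
  obtain ⟨P, hP⟩ := maxPairs_nonempty H lam
  have h1 := pairValue_le_aPlus hη k hP
  have h2 := pairValue_nonneg hlam k P
  by_contra h
  push Not at h
  nlinarith [mul_pos (neg_pos.2 h) hη]

theorem aMinus_le_one (hη : 0 < eta H lam) (hlam : ∀ i, 0 < lam i) (k : W) :
    aMinus H lam k ≤ 1 := by
  obtain ⟨P, hP⟩ := maxPairs_nonempty H lam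
  have h1 := aMinus_le_pairValue hη k hP
  have h2 := pairValue_le hlam k hP
  have h3 : aMinus H lam k * (2 * eta H lam) ≤ 1 * (2 * eta H lam) := by linarith
  exact le_of_mul_le_mul_right h3 (by positivity)

/-- The two tails for every colour, with `b = 2a⁺` and `b = -2a⁻`, are combined by a union bound
over `W × Bool`. -/
theorem eventually_dense (hH : ∃ i j, H.Adj i j) (hlam : ∀ i, 0 < lam i) {ε : ℝ} (hε : 0 < ε)
    {f : ℕ → ℝ} (hf : Tendsto f atTop atTop) :
    ∀ᶠ n : ℕ in atTop, ∀ (V : Type*) [Fintype V] [Nonempty V] (G : SimpleGraph V)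
      (s : V → Prop), RegularBipartition G s n → ∀ p : ℝ, 0 ≤ p → p ≤ 1 → f n / n ≤ p →
        1 - ε ≤ percProb G p {G' | ∀ k : W,
          colProb G' H lam {c | proportion k c ∈ badSet H lam k ε} ≤ ε ∧
          meanProportion G' H lam k ∈ Set.Icc (aMinus H lam k - ε) (aPlus H lam k + ε)} := by
  classical
  have hη := eta_pos hH hlam
  -- Small enough for the `2|W|` failure probabilities to sum to at most `ε`, and at most `ε / 2`,
  -- so that in the mean it adds to a deviation of `ε / 2`. The `+ 1` secures the latter and a
  -- nonzero denominator for every `W`.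
  set ρ := ε / (2 * (Fintype.card W + 1)) with hρ
  have hρ0 : 0 < ρ := by positivity
  have hρε : ρ ≤ ε / 2 := by
    rw [hρ]
    have : (1 : ℝ) ≤ Fintype.card W + 1 := by
      have : (0 : ℝ) ≤ Fintype.card W := by positivity
      linarith
    gcongr
    linarith
  have hsum : ∑ _x : W × Bool, ρ ≤ ε := by
    have h1 : ρ * (2 * (Fintype.card W + 1)) = ε := by rw [hρ]; field_simp
    simp only [Finset.sum_const, Finset.card_univ, Fintype.card_prod, Fintype.card_bool,
      nsmul_eq_mul]
    push_cast
    linarith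
  have key : ∀ x ∈ (Finset.univ : Finset (W × Bool)), ∀ᶠ n : ℕ in atTop,
      ∀ (V : Type _) [Fintype V] [Nonempty V] (G : SimpleGraph V)
      (s : V → Prop), RegularBipartition G s n → ∀ p : ℝ, 0 ≤ p → f n / n ≤ p → p ≤ 1 →
        1 - ρ ≤ percProb G p {G' | colProb G' H lam
          {c | (if x.2 then 2 * aPlus H lam x.1 else -(2 * aMinus H lam x.1)) / 2 + ε / 2 ≤
            (if x.2 then 1 else -1) * proportion x.1 c} ≤ ρ} := by
    rintro ⟨k, _ | _⟩ -
    · refine eventually_colProb_tail_le hH hlam k _ (fun P hP => ?_) (half_pos hε) hρ0 hf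
      have := aMinus_le_pairValue hη k hP
      simp only [Bool.false_eq_true, if_false]
      linarith
    · refine eventually_colProb_tail_le hH hlam k _ (fun P hP => ?_) (half_pos hε) hρ0 hf
      have := pairValue_le_aPlus hη k hP
      simp only [if_true]
      linarith
  rw [← Filter.eventually_all_finset] at key
  filter_upwards [key, eventually_gt_atTop 0] with n hn hn0 V _ _ G s h p hp0 hp1 hp
  have h1 := one_sub_sum_le_percProb Finset.univ hp0 hp1 _ (fun _ => ρ)
    (fun x hx => hn x hx V G s h p hp0 hp hp1)
  refine le_trans (by linarith) (h1.trans (percProb_mono hp0 hp1 fun G' hG' hb k => ?_))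
  simp only [Set.mem_ofPred_eq] at hb
  have hZ : 0 < partitionFn G' H lam :=
    lt_of_lt_of_le (by positivity)
      (h.eta_pow_le_partitionFn (H := H) hn0 hG' hlam (h.card_eq_two_mul hn0))
  have hb1 := hb (k, true) (Finset.mem_univ _)
  have hb2 := hb (k, false) (Finset.mem_univ _)
  simp only [if_true, Bool.false_eq_true, if_false] at hb1 hb2
  set S1 := {c : V → W | 2 * aPlus H lam k / 2 + ε / 2 ≤ 1 * proportion k c} with hS1
  set S2 := {c : V → W | -(2 * aMinus H lam k) / 2 + ε / 2 ≤ -1 * proportion k c} with hS2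
  refine ⟨?_, ?_, ?_⟩
  · have : {c : V → W | proportion k c ∈ badSet H lam k ε} ⊆ S1 ∪ S2 := by
      rintro c (hc | hc)
      · right
        have := hc.2
        simp only [hS2, Set.mem_ofPred_eq]
        linarith
      · left
        have := hc.1
        simp only [hS1, Set.mem_ofPred_eq]
        linarith
    have h2 := (colProb_mono (G := G') (H := H) hlam this).trans (colProb_union_le hlam _ _)
    linarith
  · rw [meanProportion_eq_colExp]
    -- Off `S2` the proportion is large enough; on `S2` the indicator makes up for it because `a⁻ ≤
    -- 1`.
    have h2 : colExp G' H lam (fun _ => aMinus H lam k - ε / 2) ≤ colExp G' H lam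
        (fun c => proportion k c + if c ∈ S2 then 1 else 0) := by
      refine colExp_mono hlam fun c _ => ?_
      split_ifs with hc
      · have := aMinus_le_one hη hlam k
        have := proportion_nonneg k c
        linarith
      · simp only [hS2, Set.mem_ofPred_eq, not_le] at hc
        linarith
    rw [colExp_const hZ, colExp_add, ← colProb_eq_colExp] at h2
    change _ ≤ colExp G' H lam (proportion k) + _ at h2
    linarith
  · rw [meanProportion_eq_colExp]
    have h2 : colExp G' H lam (proportion k) ≤ colExp G' H lam
        (fun c => (aPlus H lam k + ε / 2) + if c ∈ S1 then 1 else 0) := by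
      refine colExp_mono hlam fun c _ => ?_
      split_ifs with hc
      · have := aPlus_nonneg hη hlam k
        have := proportion_le_one k c
        linarith
      · simp only [hS1, Set.mem_ofPred_eq, not_le] at hc
        linarith
    rw [colExp_add, colExp_const hZ, ← colProb_eq_colExp] at h2
    linarith

end Dense

/-! ### The sparse regime -/

section Sparse

variable {V W : Type*} [Fintype V] [Fintype W] {G : SimpleGraph V} {H : LoopGraph W}
  {lam : W → ℝ}

open Classical in
/-- The vertices with at least one neighbour. -/
noncomputable def nonIsolated (G : SimpleGraph V) : Finset V :=
  Finset.univ.filter fun v => ∃ u, G.Adj v u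

/-- A vertex of degree at most `n` is isolated with probability at least `1 - np`. -/
theorem percExp_mem_nonIsolated_le {n : ℕ} (v : V) [∀ G' : SimpleGraph V,
    Decidable (v ∈ nonIsolated G')] (hv : (G.neighborSet v).ncard ≤ n) {p : ℝ}
    (hp : 0 ≤ p) (hp1 : p ≤ 1) :
    percExp G p (fun G' => if v ∈ nonIsolated G' then 1 else 0) ≤ n * p := by
  classical
  -- With the vertices as colours and `v` made isolated in the target, the identity is an
  -- `H'`-colouring of `G'` exactly when `v` is isolated in `G'`. Its bad edges are the edges at
  -- `v`, so `percExp_mem_homs` applies.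
  let H' : LoopGraph V := ⟨fun i j => i ≠ v ∧ j ≠ v, fun i j h => ⟨h.2, h.1⟩⟩
  have h1 : ∀ G', (if v ∈ nonIsolated G' then (1 : ℝ) else 0)
      = 1 + (-1) * (if (id : V → V) ∈ homs G' H' then 1 else 0) := by
    intro G'
    have : v ∈ nonIsolated G' ↔ (id : V → V) ∉ homs G' H' := by
      simp only [nonIsolated, homs, Finset.mem_filter, Finset.mem_univ, true_and, id, H']
      constructor
      · rintro ⟨u, hu⟩ h; exact (h _ _ hu).1 rfl
      · intro h
        push Not at h
        obtain ⟨a, b, hab, h⟩ := h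
        by_cases ha : a = v
        · exact ⟨b, ha ▸ hab⟩
        · exact ⟨a, (h ha) ▸ hab.symm⟩
    by_cases h : v ∈ nonIsolated G'
    · simp [h, this.1 h]
    · simp [h, not_not.1 (fun h' => h (this.2 h'))]
  simp only [h1]
  rw [percExp_add, percExp_const, percExp_mul, percExp_mem_homs]
  have h2 : (badEdges H' G id).card ≤ n := by
    refine le_trans ?_ hv
    have : badEdges H' G id ⊆ (G.neighborSet v).toFinset.image fun u => s(v, u) := by
      intro e he
      simp only [badEdges, Finset.mem_filter, SimpleGraph.mem_edgeFinset] at he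
      obtain ⟨he, a, b, rfl, h⟩ := he
      rw [SimpleGraph.mem_edgeSet] at he
      simp only [Finset.mem_image, Set.mem_toFinset, SimpleGraph.mem_neighborSet]
      by_cases ha : a = v
      · exact ⟨b, ha ▸ he, by rw [ha]⟩
      · have hb : b = v := by
          by_contra hb
          exact h ⟨ha, hb⟩
        exact ⟨a, hb ▸ he.symm, by rw [hb, Sym2.eq_swap]⟩
    rw [Set.ncard_eq_toFinset_card']
    exact (Finset.card_le_card this).trans Finset.card_image_le
  have h3 : (1 - p) ^ n ≤ (1 - p) ^ (badEdges H' G id).card :=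
    pow_le_pow_of_le_one (by linarith) (by linarith) h2
  have h4 := one_add_mul_le_pow (a := -p) (by linarith) n
  rw [← sub_eq_add_neg] at h4
  linarith

theorem percExp_card_nonIsolated_le {n : ℕ} (h : ∀ v, (G.neighborSet v).ncard ≤ n) {p : ℝ}
    (hp : 0 ≤ p) (hp1 : p ≤ 1) :
    percExp G p (fun G' => ((nonIsolated G').card : ℝ)) ≤ Fintype.card V * (n * p) := by
  classical
  have h1 : (fun G' : SimpleGraph V => ((nonIsolated G').card : ℝ))
      = fun G' => ∑ v, if v ∈ nonIsolated G' then 1 else 0 := by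
    funext G'; simp
  rw [h1, percExp_sum]
  refine (Finset.sum_le_sum fun v _ => percExp_mem_nonIsolated_le v (h v) hp hp1).trans_eq ?_
  simp

open Classical in
/-- The colour of an isolated vertex is independent of the other colours. -/
theorem colExp_isolated_eq_zero (v : V) (hv : v ∉ nonIsolated G) (hw : 0 < setWeight lam .univ)
    (k : W) (X : (V → W) → ℝ) (hX : ∀ c i, X (Function.update c v i) = X c) :
    colExp G H lam (fun c =>
      ((if c v = k then 1 else 0) - lam k / setWeight lam Finset.univ) * X c) = 0 := by
  have h1 : colExp G H lam (fun c =>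
      ((if c v = k then 1 else 0) - lam k / setWeight lam Finset.univ) * X c)
      = ∑ c : V → W, (if c ∈ homs G H then colWeight lam c / partitionFn G H lam *
        (((if c v = k then 1 else 0) - lam k / setWeight lam Finset.univ) * X c) else 0) := by
    rw [colExp]
    simp
  -- For each fixed colouring `b` of the other vertices, the sum over the colour `i` of `v` already
  -- vanishes, because `∑ i, λ_i (1_{i = k} - λ_k / w) = 0`. The colour given to `v` in `c0` is
  -- immaterial.
  rw [h1, ← (Equiv.funSplitAt v W).symm.sum_comp, Fintype.sum_prod_type_right]
  refine Finset.sum_eq_zero fun b _ => ?_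
  set c0 : V → W := (Equiv.funSplitAt v W).symm (k, b) with hc0
  have hc : ∀ i, (Equiv.funSplitAt v W).symm (i, b) = Function.update c0 v i := by
    intro i
    funext u
    by_cases hu : u = v
    · subst hu; simp [Equiv.funSplitAt, Equiv.piSplitAt]
    · simp [hc0, Equiv.funSplitAt, Equiv.piSplitAt, hu]
  have hhom : ∀ i, Function.update c0 v i ∈ homs G H ↔ c0 ∈ homs G H := by
    intro i
    simp only [nonIsolated, Finset.mem_filter, Finset.mem_univ, true_and, not_exists] at hv
    simp only [homs, Finset.mem_filter, Finset.mem_univ, true_and]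
    refine forall_congr' fun a => forall_congr' fun b => forall_congr' fun hab => ?_
    have ha : a ≠ v := by rintro rfl; exact hv _ hab
    have hb : b ≠ v := by rintro rfl; exact hv _ hab.symm
    simp [ha, hb]
  have hcw : ∀ i, colWeight lam (Function.update c0 v i)
      = lam i * ∏ u ∈ Finset.univ.erase v, lam (c0 u) := by
    intro i
    rw [colWeight, ← Finset.mul_prod_erase _ _ (Finset.mem_univ v), Function.update_self]
    congr 1
    refine Finset.prod_congr rfl fun u hu => ?_
    rw [Function.update_of_ne (Finset.ne_of_mem_erase hu)]
  simp only [hc, hhom, hcw, hX, Function.update_self]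
  split_ifs
  · set Q := ∏ u ∈ Finset.univ.erase v, lam (c0 u)
    have : ∀ i, lam i * Q / partitionFn G H lam *
        (((if i = k then 1 else 0) - lam k / setWeight lam Finset.univ) * X c0)
        = ((if i = k then lam i else 0) - lam i * (lam k / setWeight lam Finset.univ)) *
          (Q / partitionFn G H lam * X c0) := by
      intro i
      split_ifs <;> ring
    simp only [this]
    rw [← Finset.sum_mul, Finset.sum_sub_distrib, ← Finset.sum_mul]
    simp only [Finset.sum_ite_eq', Finset.mem_univ, if_true]
    change (lam k - setWeight lam Finset.univ * _) * _ = 0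
    rw [mul_div_cancel₀ _ hw.ne', sub_self, zero_mul]
  · simp

/-- Expanding the square gives a double sum of covariance-like terms, each at most `1`. An
off-diagonal term vanishes as soon as one of its two vertices is isolated, leaving the diagonal and
the pairs of non-isolated vertices. -/
theorem colExp_sq_le [Nonempty V] (hlam : ∀ i, 0 < lam i) (hZ : 0 < partitionFn G H lam) (k : W) :
    colExp G H lam (fun c => (proportion k c - lam k / setWeight lam Finset.univ) ^ 2)
      ≤ 1 / Fintype.card V + ((nonIsolated G).card / Fintype.card V : ℝ) ^ 2 := by
  classical
  have hw : 0 < setWeight lam Finset.univ :=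
    Finset.sum_pos (fun i _ => hlam i) ⟨k, Finset.mem_univ _⟩
  set q := lam k / setWeight lam Finset.univ with hq
  have hq0 : 0 ≤ q := div_nonneg (hlam k).le hw.le
  have hq1 : q ≤ 1 := div_le_one_of_le₀
    (Finset.single_le_sum (fun i _ => (hlam i).le) (Finset.mem_univ k)) hw.le
  have hV : (0 : ℝ) < Fintype.card V := by exact_mod_cast Fintype.card_pos
  set Y : V → (V → W) → ℝ := fun v c => (if c v = k then 1 else 0) - q with hY
  have hYle : ∀ v c, |Y v c| ≤ 1 := by
    intro v c
    simp only [hY, abs_le]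
    split_ifs <;> constructor <;> linarith
  have h1 : ∀ c : V → W, (proportion k c - q) ^ 2
      = (1 / (Fintype.card V : ℝ) ^ 2) * ∑ u, ∑ v, Y u c * Y v c := by
    intro c
    have : proportion k c - q = (1 / (Fintype.card V : ℝ)) * ∑ v, Y v c := by
      simp only [hY, Finset.sum_sub_distrib, Finset.sum_boole, Finset.sum_const,
        Finset.card_univ, nsmul_eq_mul, proportion]
      field_simp
    rw [this, mul_pow, sq (∑ v, Y v c), Finset.sum_mul_sum, one_div_pow]
  have h2 : ∀ u v, colExp G H lam (fun c => Y u c * Y v c)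
      ≤ (if u = v then 1 else 0) + (if u ∈ nonIsolated G then 1 else 0) *
        (if v ∈ nonIsolated G then 1 else 0) := by
    intro u v
    have hone : colExp G H lam (fun c => Y u c * Y v c) ≤ 1 := by
      refine (colExp_mono hlam fun c _ => ?_).trans_eq (colExp_const hZ 1)
      refine (le_abs_self _).trans ?_
      rw [abs_mul]
      exact mul_le_one₀ (hYle u c) (abs_nonneg _) (hYle v c)
    by_cases huv : u = v
    · rw [if_pos huv]
      have : (0 : ℝ) ≤ (if u ∈ nonIsolated G then 1 else 0) *
        (if v ∈ nonIsolated G then 1 else 0) := by split_ifs <;> simp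
      linarith
    · rw [if_neg huv, zero_add]
      by_cases hu : u ∈ nonIsolated G
      · by_cases hv : v ∈ nonIsolated G
        · rwa [if_pos hu, if_pos hv, mul_one]
        · rw [if_neg hv, mul_zero]
          have := colExp_isolated_eq_zero (H := H) v hv hw k (Y u) fun c i => by
            simp [hY, Function.update_of_ne huv]
          simp only [mul_comm (Y u _)]
          exact this.le
      · rw [if_neg hu, zero_mul]
        exact (colExp_isolated_eq_zero (H := H) u hu hw k (Y v) fun c i => by
            simp [hY, Function.update_of_ne (Ne.symm huv)]).le
  simp only [h1]
  rw [colExp_mul, colExp_sum]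
  simp only [colExp_sum]
  calc _ ≤ 1 / (Fintype.card V : ℝ) ^ 2 * ∑ u : V, ∑ v : V, ((if u = v then (1 : ℝ) else 0) +
        (if u ∈ nonIsolated G then 1 else 0) * (if v ∈ nonIsolated G then 1 else 0)) := by
        gcongr with u _ v _
        exact h2 u v
    _ = 1 / (Fintype.card V : ℝ) ^ 2 * (Fintype.card V + ((nonIsolated G).card : ℝ) ^ 2) := by
        simp only [Finset.sum_add_distrib, ← Finset.mul_sum, ← Finset.sum_mul]
        simp [sq]
    _ = _ := by field_simp

/-- The expected fraction of non-isolated vertices is at most `np ≤ 1 / f(n)`. Markov's inequality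
makes it small for a typical `G_p`, and Chebyshev's inequality does the rest. -/
theorem eventually_sparse (hH : ∃ i j, H.Adj i j) (hlam : ∀ i, 0 < lam i) {ε : ℝ} (hε : 0 < ε)
    {f : ℕ → ℝ} (hf : Tendsto f atTop atTop) :
    ∀ᶠ n : ℕ in atTop, ∀ (V : Type*) [Fintype V] [Nonempty V] (G : SimpleGraph V)
      (s : V → Prop), RegularBipartition G s n → ∀ p : ℝ, 0 ≤ p → p ≤ 1 → p ≤ 1 / (f n * n) →
        1 - ε ≤ percProb G p {G' | ∀ k : W,
          1 - ε ≤ colProb G' H lam {c | |proportion k c - lam k / setWeight lam Finset.univ| ≤ ε} ∧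
          |meanProportion G' H lam k - lam k / setWeight lam Finset.univ| ≤ ε} := by
  classical
  have hη := eta_pos hH hlam
  -- Chebyshev with deviation `ε / 2` and failure probability `ε / 2` needs a second moment of at
  -- most `(ε / 2) ^ 3`, half for each term of `colExp_sq_le`. `δ` bounds the fraction of
  -- non-isolated vertices.
  obtain ⟨δ, hδ0, hδ⟩ : ∃ δ : ℝ, 0 < δ ∧ δ ^ 2 ≤ (ε / 2) ^ 3 / 2 :=
    ⟨Real.sqrt ((ε / 2) ^ 3 / 2), Real.sqrt_pos.2 (by positivity),
      (Real.sq_sqrt (by positivity)).le⟩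
  filter_upwards [eventually_gt_atTop 0, hf.eventually_ge_atTop (1 / (ε * δ)),
    tendsto_natCast_atTop_atTop.eventually_ge_atTop (1 / ((ε / 2) ^ 3 / 2))]
    with n hn0 hfn hn V _ _ G s h p hp0 hp1 hp
  have hn0' : (0 : ℝ) < n := by exact_mod_cast hn0
  have hV : (0 : ℝ) < Fintype.card V := by exact_mod_cast Fintype.card_pos
  have hf0 : 0 < f n := lt_of_lt_of_le (by positivity) hfn
  have h1 := percExp_card_nonIsolated_le (fun v => (h.degree v).le) hp0 hp1
  have h2 : n * p ≤ δ * ε := by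
    calc n * p ≤ n * (1 / (f n * n)) := by gcongr
      _ = 1 / f n := by field_simp
      _ ≤ _ := by
        rw [div_le_iff₀ (by positivity)] at hfn
        rw [div_le_iff₀ hf0]; linarith
  have h3 := one_sub_le_percProb (x := Fintype.card V * δ) (y := ε) hp0 hp1
    (fun G' => Nat.cast_nonneg _) (by positivity)
    (h1.trans (by rw [mul_assoc]; exact mul_le_mul_of_nonneg_left h2 hV.le))
  refine h3.trans (percProb_mono hp0 hp1 fun G' hG' hb k => ?_)
  rw [Set.mem_ofPred_eq] at hb
  have hZ : 0 < partitionFn G' H lam :=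
    lt_of_lt_of_le (by positivity)
      (h.eta_pow_le_partitionFn (H := H) hn0 hG' hlam (h.card_eq_two_mul hn0))
  have hw : 0 < setWeight lam Finset.univ :=
    Finset.sum_pos (fun i _ => hlam i) ⟨k, Finset.mem_univ _⟩
  set q := lam k / setWeight lam Finset.univ with hq
  have hq0 : 0 ≤ q := div_nonneg (hlam k).le hw.le
  have hq1 : q ≤ 1 := div_le_one_of_le₀
    (Finset.single_le_sum (fun i _ => (hlam i).le) (Finset.mem_univ k)) hw.le
  set S := {c : V → W | (ε / 2) ^ 2 ≤ (proportion k c - q) ^ 2} with hS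
  have hSε : ∀ c, c ∉ S → |proportion k c - q| < ε / 2 := by
    intro c hc
    simp only [hS, Set.mem_ofPred_eq, not_le] at hc
    exact abs_lt_of_sq_lt_sq hc (by positivity)
  have hcard : (1 : ℝ) / Fintype.card V ≤ (ε / 2) ^ 3 / 2 := by
    have h4 : n ≤ Fintype.card V := by
      have := h.degree_le hn0
      have := h.card_eq_two_mul hn0
      omega
    have h5 : (n : ℝ) ≤ Fintype.card V := by exact_mod_cast h4
    rw [div_le_iff₀ (by positivity)] at hn
    rw [div_le_iff₀ hV]
    nlinarith [show 0 < (ε / 2) ^ 3 / 2 by positivity]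
  have hfrac : ((nonIsolated G').card / Fintype.card V : ℝ) ^ 2 ≤ (ε / 2) ^ 3 / 2 := by
    refine le_trans (pow_le_pow_left₀ (by positivity) ?_ 2) hδ
    rw [div_le_iff₀ hV]; linarith
  have hSp : colProb G' H lam S ≤ ε / 2 := by
    refine (colProb_le_colExp_div hlam (fun c => sq_nonneg _) (by positivity)).trans ?_
    rw [div_le_iff₀ (by positivity)]
    refine (colExp_sq_le hlam hZ k).trans ?_
    calc _ ≤ (ε / 2) ^ 3 / 2 + (ε / 2) ^ 3 / 2 := add_le_add hcard hfrac
      _ = _ := by ring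
  constructor
  · have h4 := colProb_mono (G := G') (H := H) hlam (S := Sᶜ)
      (S' := {c | |proportion k c - q| ≤ ε}) fun c hc => by
        have := hSε c hc
        rw [Set.mem_ofPred_eq]; linarith
    rw [colProb_compl hZ] at h4
    linarith
  · have habs : ∀ c : V → W, |proportion k c - q| ≤ ε / 2 + if c ∈ S then 1 else 0 := by
      intro c
      split_ifs with hc
      · have := proportion_nonneg k c
        have := proportion_le_one k c
        rw [abs_le]; constructor <;> linarith
      · rw [add_zero]; exact (hSε c hc).le
    rw [meanProportion_eq_colExp]
    have h5 : colExp G' H lam (proportion k) ≤ colExp G' H lam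
        (fun c => (q + ε / 2) + if c ∈ S then 1 else 0) :=
      colExp_mono hlam fun c _ => by linarith [(abs_le.1 (habs c)).2]
    have h6 : colExp G' H lam (fun _ => q - ε / 2) ≤ colExp G' H lam
        (fun c => proportion k c + if c ∈ S then 1 else 0) :=
      colExp_mono hlam fun c _ => by linarith [(abs_le.1 (habs c)).1]
    rw [colExp_add, colExp_const hZ, ← colProb_eq_colExp] at h5
    rw [colExp_add, colExp_const hZ, ← colProb_eq_colExp] at h6
    change _ ≤ colExp G' H lam (proportion k) + _ at h6
    rw [abs_le]; constructor <;> linarith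

end Sparse

/-! ### Choice of the bipartition and of the null sequence -/

theorem regularBipartition_of_isBipartite {V : Type*} [Fintype V] {G : SimpleGraph V}
    [DecidableRel G.Adj] (hG : G.IsBipartite) {n : ℕ} (hn : G.IsRegularOfDegree n) :
    ∃ s : V → Prop, RegularBipartition G s n := by
  obtain ⟨C⟩ := hG
  refine ⟨fun v => C v = 0, fun u v huv => ?_, fun v => ?_⟩
  · have := C.valid huv
    omega
  · rw [← hn v, ← SimpleGraph.card_neighborSet_eq_degree, Set.ncard_eq_toFinset_card',
      Set.toFinset_card]

/-- A property that eventually holds for each `ε > 0`, and always for `ε = 1`, always holds for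
some null sequence. -/
theorem exists_tendsto_zero_forall {P : ℝ → ℕ → Prop} (h : ∀ ε > 0, ∀ᶠ n in atTop, P ε n)
    (h1 : ∀ n, P 1 n) : ∃ g : ℕ → ℝ, Tendsto g atTop (𝓝 0) ∧ ∀ n, P (g n) n := by
  classical
  -- The best `j ≤ n` for which `1 / (j + 1)` works at `n`; `j = 0` always works by `h1`, which also
  -- makes the default value `0` harmless.
  set J : ℕ → ℕ := fun n => Nat.findGreatest (fun j => P (1 / ((j : ℝ) + 1)) n) n with hJ
  refine ⟨fun n => 1 / ((J n : ℝ) + 1), ?_, fun n => ?_⟩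
  · refine tendsto_one_div_add_atTop_nhds_zero_nat.comp (tendsto_atTop.2 fun j => ?_)
    filter_upwards [h (1 / ((j : ℝ) + 1)) (by positivity), eventually_ge_atTop j] with n hn hj
    exact Nat.le_findGreatest hj hn
  · exact Nat.findGreatest_spec (P := fun j : ℕ => P (1 / ((j : ℝ) + 1)) n) (Nat.zero_le n)
      (by simpa using h1 n)

end HColouring

theorem corollary1p8 {W : Type*} [Fintype W] (H : HColouring.LoopGraph W)
    (hH : ∃ i j, H.Adj i j) (lam : W → ℝ) (hlam : ∀ i, 0 < lam i)
    (f : ℕ → ℝ) (hf : Tendsto f atTop atTop) :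
    ∃ g : ℕ → ℝ, Tendsto g atTop (𝓝 0) ∧
      ∀ (n : ℕ), 1 ≤ n →
      ∀ (V : Type*) [Fintype V] [Nonempty V] (G : SimpleGraph V) [DecidableRel G.Adj],
        G.IsBipartite → G.IsRegularOfDegree n →
      ∀ p : ℝ, 0 ≤ p → p ≤ 1 →
        (f n / n ≤ p →
          1 - g n ≤ HColouring.percProb G p {G' | ∀ k : W,
            HColouring.colProb G' H lam
              {c | HColouring.proportion k c ∈ HColouring.badSet H lam k (g n)} ≤ g n ∧
            HColouring.meanProportion G' H lam k ∈
              Set.Icc (HColouring.aMinus H lam k - g n) (HColouring.aPlus H lam k + g n)}) ∧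
        (p ≤ 1 / (f n * n) →
          1 - g n ≤ HColouring.percProb G p {G' | ∀ k : W,
            1 - g n ≤ HColouring.colProb G' H lam
              {c | |HColouring.proportion k c - lam k / HColouring.setWeight lam Finset.univ|
                ≤ g n} ∧
            |HColouring.meanProportion G' H lam k
                - lam k / HColouring.setWeight lam Finset.univ| ≤ g n}) := by
  obtain ⟨g, hg, h⟩ := HColouring.exists_tendsto_zero_forall
    (P := fun ε n => ∀ (V : Type _) [Fintype V] [Nonempty V] (G : SimpleGraph V)
      (s : V → Prop), HColouring.RegularBipartition G s n → ∀ p : ℝ, 0 ≤ p → p ≤ 1 →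
      (f n / n ≤ p →
          1 - ε ≤ HColouring.percProb G p {G' | ∀ k : W,
            HColouring.colProb G' H lam
              {c | HColouring.proportion k c ∈ HColouring.badSet H lam k ε} ≤ ε ∧
            HColouring.meanProportion G' H lam k ∈
              Set.Icc (HColouring.aMinus H lam k - ε) (HColouring.aPlus H lam k + ε)}) ∧
        (p ≤ 1 / (f n * n) →
          1 - ε ≤ HColouring.percProb G p {G' | ∀ k : W,
            1 - ε ≤ HColouring.colProb G' H lam
              {c | |HColouring.proportion k c - lam k / HColouring.setWeight lam Finset.univ|
                ≤ ε} ∧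
            |HColouring.meanProportion G' H lam k
                - lam k / HColouring.setWeight lam Finset.univ| ≤ ε}))
    (fun ε hε => by
      filter_upwards [HColouring.eventually_dense hH hlam hε hf,
        HColouring.eventually_sparse hH hlam hε hf] with n h1 h2 V _ _ G s h p hp hp1
      exact ⟨h1 V G s h p hp hp1, h2 V G s h p hp hp1⟩)
    -- For `ε = 1` only nonnegativity of a probability is asked.
    (fun n V _ _ G s h p hp hp1 => by
      rw [sub_self]
      exact ⟨fun _ => HColouring.percProb_nonneg hp hp1 _,
        fun _ => HColouring.percProb_nonneg hp hp1 _⟩)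
  refine ⟨g, hg, fun n _ V _ _ G _ hb hr p hp hp1 => ?_⟩
  obtain ⟨s, hs⟩ := HColouring.regularBipartition_of_isBipartite hb hr
  exact h n V G s hs p hp hp1
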